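/- Let $B_d$ be the open unit ball of $\mathbb{C}^d$ and let $H_d^2$ be the Hilbert space of functions on $B_d$ with reproducing kernel $k(z,w)=\frac{1}{1-\langle z,w\rangle}$; write $k_\lambda=k(\cdot,\lambda)\in H_d^2$. Let $\mathcal{A}_d=\mathbb{C}[z_1,\dots,z_d]$, which acts on $H_d^2$ by pointwise multiplication. An $\mathcal{A}_d$-module $\mathcal{H}$ that is a Hilbert space is contractive if $\|\sum_{k=1}^d z_k\xi_k\|^2\le\sum_{k=1}^d\|\xi_k\|^2$ for all $\xi_1,\dots,\xi_d\in\mathcal{H}$. A free module is a Hilbert space direct sum of (any number of) copies of $H_d^2$, and a spherical module is a Hilbert space on which polynomials act through a unital $*$-representation of $C(\partial B_d)$. A minimal dilation of $\mathcal{H}$ is a coisometric module homomorphism $U:\mathcal{F}\oplus\mathcal{S}\to\mathcal{H}$, with $\mathcal{F}$ free and $\mathcal{S}$ spherical, such that the closed submodule generated by $U^*\mathcal{H}$ is $\mathcal{F}\oplus\mathcal{S}$. A contractive module is pure if the spherical part $\mathcal{S}$ of any minimal dilation is zero, in other words, if it is unitarily isomorphic, as a module, to the quotient of a free module by a closed submodule.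 A Möbius transform is a continuous bijection $\varphi:\overline{B_d}\to\overline{B_d}$ that is holomorphic in $B_d$ and satisfies $\varphi(B_d)=B_d$ and $\varphi(\partial B_d)=\partial B_d$. Theorem. Let $\varphi=(\varphi^1,\dots,\varphi^d)$ be a Möbius transform. Then multiplication by $\varphi^1,\dots,\varphi^d$ defines an $\mathcal{A}_d$-module structure on the Hilbert space $H_d^2$, in which $z_i\cdot\xi=\varphi^i\xi$ for $i=1,\dots,d$, and this module $(H_d^2)_\varphi$ is contractive and pure. Furthermore, with $\lambda=\varphi^{-1}(0)\in B_d$, the map $$U_\varphi\xi=(\xi\circ\varphi)\,\frac{k_\lambda}{\|k_\lambda\|}$$ is a unitary module isomorphism from $H_d^2$ onto $(H_d^2)_\varphi$. -/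

import Mathlib

open scoped ENNReal InnerProductSpace ComplexConjugate

noncomputable section

universe u

namespace HilbertModules

/-! ## The unit ball and the space `H_d^2` -/

/-- The open unit ball of `ℂ^d`. -/
abbrev Ball (d : ℕ) : Type := Metric.ball (0 : EuclideanSpace ℂ (Fin d)) 1

/-- The kernel `k(z,w) = 1 / (1 - ⟨z,w⟩)`, where `⟨z,w⟩ = ∑ z_j * conj w_j`
(in Mathlib's convention this is `inner ℂ w z`). -/
def ker {d : ℕ} (z w : Ball d) : ℂ := 1 / (1 - inner ℂ (w : EuclideanSpace ℂ (Fin d)) z)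

/-- The kernel as an operator-valued matrix on the one-dimensional coefficient space `ℂ`. -/
def kerMatrix (d : ℕ) : Matrix (Ball d) (Ball d) (ℂ →L[ℂ] ℂ) :=
  Matrix.of fun z w => ker z w • ContinuousLinearMap.id ℂ ℂ

lemma norm_inner_lt_one {d : ℕ} (z w : Ball d) :
    ‖inner ℂ (w : EuclideanSpace ℂ (Fin d)) z‖ < 1 := by
  have hz : ‖(z : EuclideanSpace ℂ (Fin d))‖ < 1 := mem_ball_zero_iff.mp z.2
  have hw : ‖(w : EuclideanSpace ℂ (Fin d))‖ < 1 := mem_ball_zero_iff.mp w.2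
  refine (norm_inner_le_norm _ _).trans_lt ?_
  nlinarith [norm_nonneg (z : EuclideanSpace ℂ (Fin d)),
    norm_nonneg (w : EuclideanSpace ℂ (Fin d))]

lemma one_sub_inner_ne_zero {d : ℕ} (z w : Ball d) :
    1 - inner ℂ (w : EuclideanSpace ℂ (Fin d)) z ≠ 0 := by
  intro h
  have h1 := norm_inner_lt_one z w
  rw [← sub_eq_zero.mp h] at h1
  simp at h1

lemma conj_ker {d : ℕ} (z w : Ball d) : conj (ker z w) = ker w z := by
  simp [ker, inner_conj_symm]

lemma inner_eq_sum {d : ℕ} (z w : Ball d) :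
    inner ℂ (w : EuclideanSpace ℂ (Fin d)) z = ∑ j, z.1 j * conj (w.1 j) := by
  simp [PiLp.inner_apply]

lemma sum_pow_nonneg {d : ℕ} (n : ℕ) (s : Finset (Ball d)) (c : Ball d → ℂ) :
    0 ≤ (∑ w ∈ s, ∑ z ∈ s, c w * conj (c z) *
      (inner ℂ (w : EuclideanSpace ℂ (Fin d)) z) ^ n).re := by
  induction n generalizing c with
  | zero =>
    have : (∑ w ∈ s, ∑ z ∈ s, c w * conj (c z) *
        (inner ℂ (w : EuclideanSpace ℂ (Fin d)) z) ^ 0)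
        = (∑ w ∈ s, c w) * conj (∑ z ∈ s, c z) := by
      simp [Finset.sum_mul_sum, map_sum]
    rw [this, Complex.mul_conj, Complex.ofReal_re]
    exact Complex.normSq_nonneg _
  | succ n ih =>
    have : (∑ w ∈ s, ∑ z ∈ s, c w * conj (c z) *
        (inner ℂ (w : EuclideanSpace ℂ (Fin d)) z) ^ (n + 1))
        = ∑ j, ∑ w ∈ s, ∑ z ∈ s, (c w * conj (w.1 j)) * conj (c z * conj (z.1 j)) *
          (inner ℂ (w : EuclideanSpace ℂ (Fin d)) z) ^ n := by
      rw [Finset.sum_comm (s := Finset.univ)]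
      refine Finset.sum_congr rfl fun w _ => ?_
      rw [Finset.sum_comm (s := Finset.univ)]
      refine Finset.sum_congr rfl fun z _ => ?_
      rw [← Finset.sum_mul, pow_succ', ← mul_assoc]
      congr 1
      rw [inner_eq_sum z w, Finset.mul_sum]
      refine Finset.sum_congr rfl fun j _ => ?_
      simp
      ring
    rw [this, Complex.re_sum]
    exact Finset.sum_nonneg fun j _ => ih _

lemma sum_ker_nonneg {d : ℕ} (s : Finset (Ball d)) (c : Ball d → ℂ) :
    0 ≤ (∑ w ∈ s, ∑ z ∈ s, c w * conj (c z) * ker z w).re := by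
  have h : HasSum (fun n : ℕ => ∑ w ∈ s, ∑ z ∈ s, c w * conj (c z) *
      (inner ℂ (w : EuclideanSpace ℂ (Fin d)) z) ^ n)
      (∑ w ∈ s, ∑ z ∈ s, c w * conj (c z) * ker z w) := by
    refine hasSum_sum fun w _ => hasSum_sum fun z _ => ?_
    refine HasSum.mul_left _ ?_
    have := hasSum_geometric_of_norm_lt_one (norm_inner_lt_one z w)
    simpa [ker] using this
  exact (Complex.hasSum_re h).nonneg fun n => sum_pow_nonneg n s c

lemma posSemidef_kerMatrix (d : ℕ) : (kerMatrix d).PosSemidef := by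
  refine ((RKHS.posSemidef_tfae (K := kerMatrix d)).out 0 2).mpr ?_
  refine ⟨?_, fun vv => ?_⟩
  · ext z w
    have h : ContinuousLinearMap.adjoint (ContinuousLinearMap.id ℂ ℂ)
        = ContinuousLinearMap.id ℂ ℂ := star_one (ℂ →L[ℂ] ℂ)
    simp [kerMatrix, ContinuousLinearMap.star_eq_adjoint, conj_ker, h]
  · have h := sum_ker_nonneg vv.support vv
    refine h.trans_eq ?_
    simp [Finsupp.sum, map_sum, kerMatrix, conj_ker]
    simp only [← Finset.sum_sub_distrib]
    refine Finset.sum_congr rfl fun x _ => Finset.sum_congr rfl fun y _ => ?_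
    rw [← conj_ker x y, Complex.conj_re, Complex.conj_im]
    ring

instance (d : ℕ) : Fact (kerMatrix d).PosSemidef := ⟨posSemidef_kerMatrix d⟩

/-- The Hilbert space `H_d^2` of functions on the unit ball with reproducing kernel
`k(z,w) = 1 / (1 - ⟨z,w⟩)`. -/
def H2 (d : ℕ) : Type := RKHS.OfKernel (kerMatrix d)

instance (d : ℕ) : NormedAddCommGroup (H2 d) :=
  inferInstanceAs (NormedAddCommGroup (RKHS.OfKernel (kerMatrix d)))

instance (d : ℕ) : InnerProductSpace ℂ (H2 d) :=
  inferInstanceAs (InnerProductSpace ℂ (RKHS.OfKernel (kerMatrix d)))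

instance (d : ℕ) : CompleteSpace (H2 d) :=
  inferInstanceAs (CompleteSpace (RKHS.OfKernel (kerMatrix d)))

instance (d : ℕ) : RKHS ℂ (H2 d) (Ball d) ℂ :=
  inferInstanceAs (RKHS ℂ (RKHS.OfKernel (kerMatrix d)) (Ball d) ℂ)

lemma kernel_H2 (d : ℕ) : RKHS.kernel (H2 d) = kerMatrix d :=
  RKHS.OfKernel.kernel_ofKernel (K := kerMatrix d)

/-- The kernel function `k_w : z ↦ k(z,w)`, as an element of `H_d^2`. -/
def kfun {d : ℕ} (w : Ball d) : H2 d := RKHS.kerFun (H2 d) w (1 : ℂ)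

lemma kfun_apply {d : ℕ} (w z : Ball d) : kfun w z = ker z w := by
  rw [kfun, RKHS.kerFun_apply, kernel_H2]
  simp [kerMatrix]

lemma inner_kfun {d : ℕ} (w : Ball d) (f : H2 d) : inner ℂ (kfun w) f = f w := by
  simp [kfun]


/-! ## Multiplication operators on `H_d^2` -/

/-- Finite linear combinations of kernel functions are dense. -/
lemma denseRange_kfun (d : ℕ) :
    DenseRange (Finsupp.linearCombination ℂ (kfun : Ball d → H2 d)) := by
  have h : (LinearMap.range
      (Finsupp.linearCombination ℂ (kfun : Ball d → H2 d))).topologicalClosure = ⊤ := by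
    rw [Submodule.topologicalClosure_eq_top_iff, Submodule.eq_bot_iff]
    intro f hf
    refine RKHS.ext fun z => ?_
    rw [← inner_kfun z f]
    have := (Submodule.mem_orthogonal _ f).mp hf (kfun z) ⟨Finsupp.single z 1, by simp⟩
    rw [this]
    simp
  intro x
  have hx : x ∈ (LinearMap.range
      (Finsupp.linearCombination ℂ (kfun : Ball d → H2 d))).topologicalClosure := by
    rw [h]; trivial
  rwa [← SetLike.mem_coe, Submodule.topologicalClosure_coe, LinearMap.coe_range] at hx

lemma exists_mul_of_bound {d : ℕ} (g : Ball d → ℂ)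
    (h : ∀ c : Ball d →₀ ℂ,
      ‖Finsupp.linearCombination ℂ (fun w => conj (g w) • (kfun w : H2 d)) c‖
        ≤ 1 * ‖Finsupp.linearCombination ℂ (kfun : Ball d → H2 d) c‖) :
    ∃ T : H2 d →L[ℂ] H2 d, ∀ (ξ : H2 d) (z : Ball d), T ξ z = g z * ξ z := by
  set L := Finsupp.linearCombination ℂ (kfun : Ball d → H2 d)
  set L' := Finsupp.linearCombination ℂ (fun w => conj (g w) • (kfun w : H2 d))
  refine ⟨(L'.extendOfNorm L).adjoint, fun ξ z => ?_⟩
  have h1 : L'.extendOfNorm L (kfun z) = conj (g z) • kfun z := by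
    have := LinearMap.extendOfNorm_eq (f := L') (e := L) (denseRange_kfun d) ⟨1, h⟩
      (Finsupp.single z 1)
    simpa [L, L'] using this
  rw [← inner_kfun, ContinuousLinearMap.adjoint_inner_right, h1, inner_smul_left, inner_kfun]
  simp

lemma norm_sq_linearCombination {d : ℕ} (c : Ball d →₀ ℂ) (a : Ball d → ℂ) :
    ((‖Finsupp.linearCombination ℂ (fun w => a w • (kfun w : H2 d)) c‖ ^ 2 : ℝ) : ℂ)
      = ∑ w ∈ c.support, ∑ z ∈ c.support,
          conj (c w * a w) * (c z * a z) * ker w z := by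
  have h := inner_self_eq_norm_sq_to_K (𝕜 := ℂ)
    (Finsupp.linearCombination ℂ (fun w => a w • (kfun w : H2 d)) c)
  push_cast
  refine h.symm.trans ?_
  simp only [Finsupp.linearCombination_apply, Finsupp.sum, smul_smul]
  rw [sum_inner]
  simp only [inner_sum, inner_smul_left, inner_smul_right, inner_kfun, kfun_apply]
  refine Finset.sum_congr rfl fun w _ => Finset.sum_congr rfl fun z _ => ?_
  ring

lemma sum_norm_sq_linearCombination {d : ℕ} (c : Ball d →₀ ℂ) :
    (∑ j : Fin d,
      ‖Finsupp.linearCombination ℂ (fun w => conj (w.1 j) • (kfun w : H2 d)) c‖ ^ 2)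
      + ‖∑ w ∈ c.support, c w‖ ^ 2
      = ‖Finsupp.linearCombination ℂ (kfun : Ball d → H2 d) c‖ ^ 2 := by
  have h1 := norm_sq_linearCombination c (fun _ => 1)
  simp only [one_smul, mul_one] at h1
  apply Complex.ofReal_injective
  push_cast
  have h2 : ∀ j : Fin d, _ := fun j => norm_sq_linearCombination c (fun w => conj (w.1 j))
  push_cast at h1 h2
  rw [h1]
  simp only [h2]
  have h3 : ((‖∑ w ∈ c.support, c w‖ : ℂ)) ^ 2
      = ∑ w ∈ c.support, ∑ z ∈ c.support, conj (c w) * c z := by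
    rw [← Complex.conj_mul', map_sum, Finset.sum_mul_sum]
  rw [h3, Finset.sum_comm, ← Finset.sum_add_distrib]
  refine Finset.sum_congr rfl fun w _ => ?_
  rw [Finset.sum_comm, ← Finset.sum_add_distrib]
  refine Finset.sum_congr rfl fun z _ => ?_
  have h4 : (∑ j, w.1 j * conj (z.1 j)) * ker w z + 1 = ker w z := by
    rw [← inner_eq_sum w z, ker]
    field_simp [one_sub_inner_ne_zero w z]
    ring
  calc _ = conj (c w) * c z * ((∑ j, w.1 j * conj (z.1 j)) * ker w z + 1) := by
        rw [Finset.sum_mul, mul_add, Finset.mul_sum, mul_one]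
        congr 1
        refine Finset.sum_congr rfl fun j _ => ?_
        simp
        ring
    _ = _ := by rw [h4]

/-- Every polynomial acts on `H_d^2` as a bounded multiplication operator. -/
lemma exists_mul_polynomial {d : ℕ} (p : MvPolynomial (Fin d) ℂ) :
    ∃ T : H2 d →L[ℂ] H2 d, ∀ (ξ : H2 d) (z : Ball d),
      T ξ z = MvPolynomial.eval (fun j => z.1 j) p * ξ z := by
  induction p using MvPolynomial.induction_on with
  | C a => exact ⟨a • ContinuousLinearMap.id ℂ _, fun ξ z => by simp⟩
  | add p q hp hq =>
    obtain ⟨S, hS⟩ := hp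
    obtain ⟨T, hT⟩ := hq
    exact ⟨S + T, fun ξ z => by simp [hS, hT, add_mul]⟩
  | mul_X p i hp =>
    obtain ⟨S, hS⟩ := hp
    obtain ⟨T, hT⟩ := exists_mul_of_bound (d := d) (fun z => z.1 i) (fun c => by
      rw [one_mul]
      refine le_of_sq_le_sq ?_ (norm_nonneg _)
      rw [← sum_norm_sq_linearCombination c]
      have := Finset.single_le_sum (f := fun j : Fin d =>
        ‖Finsupp.linearCombination ℂ (fun w => conj (w.1 j) • (kfun w : H2 d)) c‖ ^ 2)
        (fun j _ => sq_nonneg _) (Finset.mem_univ i)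
      nlinarith [sq_nonneg ‖∑ w ∈ c.support, c w‖])
    exact ⟨S.comp T, fun ξ z => by simp [hS, hT, mul_assoc]⟩

/-! ## Hilbert modules over `A_d = ℂ[z_1, …, z_d]` -/

/-- An `A_d`-module structure on the Hilbert space `H` by bounded operators: `ρ p x` is `p • x`,
and the operators `ρ (X k)` form the associated commuting `d`-tuple.  (If `H` is contractive,
then the action of every polynomial is automatically bounded.) -/
abbrev HilbertModule (d : ℕ) (H : Type*) [NormedAddCommGroup H] [InnerProductSpace ℂ H] :=
  MvPolynomial (Fin d) ℂ →ₐ[ℂ] (H →L[ℂ] H)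

/-- The contractivity condition `‖∑ z_k ξ_k‖² ≤ ∑ ‖ξ_k‖²`. -/
def IsContractive {d : ℕ} {H : Type*} [NormedAddCommGroup H] [InnerProductSpace ℂ H]
    (ρ : HilbertModule d H) : Prop :=
  ∀ ξ : Fin d → H, ‖∑ k, ρ (MvPolynomial.X k) (ξ k)‖ ^ 2 ≤ ∑ k, ‖ξ k‖ ^ 2

/-- Multiplication by the polynomial `p` on `H_d^2`. -/
def mulPoly {d : ℕ} (p : MvPolynomial (Fin d) ℂ) : H2 d →L[ℂ] H2 d :=
  (exists_mul_polynomial p).choose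

lemma mulPoly_apply {d : ℕ} (p : MvPolynomial (Fin d) ℂ) (ξ : H2 d) (z : Ball d) :
    mulPoly p ξ z = MvPolynomial.eval (fun j => z.1 j) p * ξ z :=
  (exists_mul_polynomial p).choose_spec ξ z

/-- `H_d^2` as an `A_d`-module: polynomials act by pointwise multiplication. -/
def H2Module (d : ℕ) : HilbertModule d (H2 d) where
  toFun p := mulPoly p
  map_one' := by
    refine ContinuousLinearMap.ext fun ξ => RKHS.ext (H := H2 d) fun z => ?_
    simp [mulPoly_apply]
  map_mul' p q := by
    refine ContinuousLinearMap.ext fun ξ => RKHS.ext (H := H2 d) fun z => ?_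
    simp [mulPoly_apply, mul_assoc]
  map_zero' := by
    refine ContinuousLinearMap.ext fun ξ => RKHS.ext (H := H2 d) fun z => ?_
    simp [mulPoly_apply]
  map_add' p q := by
    refine ContinuousLinearMap.ext fun ξ => RKHS.ext (H := H2 d) fun z => ?_
    simp [mulPoly_apply, add_mul]
  commutes' r := by
    refine ContinuousLinearMap.ext fun ξ => RKHS.ext (H := H2 d) fun z => ?_
    simp [mulPoly_apply, Algebra.algebraMap_eq_smul_one]

lemma H2Module_apply {d : ℕ} (p : MvPolynomial (Fin d) ℂ) (ξ : H2 d) (z : Ball d) :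
    H2Module d p ξ z = MvPolynomial.eval (fun j => z.1 j) p * ξ z :=
  mulPoly_apply p ξ z

/-- The underlying Hilbert space of the free module: the Hilbert space direct sum of copies of
`H_d^2` indexed by `ι` (that is, `H_d^2 ⊗ C` with `dim C` the cardinality of `ι`). -/
abbrev Free (d : ℕ) (ι : Type*) : Type _ := lp (fun _ : ι => H2 d) 2

/-- The free module: polynomials act coordinatewise by multiplication. -/
def freeModule (d : ℕ) (ι : Type*) : HilbertModule d (Free d ι) where
  toFun p := lp.mapCLM 2 (fun _ : ι => H2Module d p) (norm_nonneg _) (fun _ => le_rfl)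
  map_one' := by ext; simp
  map_mul' p q := by ext; simp
  map_zero' := by ext; simp
  map_add' p q := by ext; simp
  commutes' r := by ext; simp [Algebra.algebraMap_eq_smul_one]

/-- The unit sphere `∂B_d`. -/
abbrev Sphere (d : ℕ) : Type := Metric.sphere (0 : EuclideanSpace ℂ (Fin d)) 1

/-- The spherical module of a (unital) `*`-representation `π` of `C(∂B_d)` on `K`: a polynomial
acts through its restriction to the sphere. -/
def sphericalModule {d : ℕ} {K : Type*} [NormedAddCommGroup K] [InnerProductSpace ℂ K]
    [CompleteSpace K] (π : C(Sphere d, ℂ) →⋆ₐ[ℂ] (K →L[ℂ] K)) : HilbertModule d K :=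
  (π : C(Sphere d, ℂ) →ₐ[ℂ] (K →L[ℂ] K)).comp
    (MvPolynomial.aeval fun j => (⟨fun z => z.1 j, by fun_prop⟩ : C(Sphere d, ℂ)))

/-- The Hilbert space direct sum of two modules. -/
def directSum {d : ℕ} {H K : Type*} [NormedAddCommGroup H] [InnerProductSpace ℂ H]
    [NormedAddCommGroup K] [InnerProductSpace ℂ K]
    (ρ : HilbertModule d H) (σ : HilbertModule d K) : HilbertModule d (WithLp 2 (H × K)) where
  toFun p := (WithLp.prodContinuousLinearEquiv 2 ℂ H K).symm.toContinuousLinearMap ∘L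
    ((ρ p ∘L WithLp.fstL 2 ℂ H K).prod (σ p ∘L WithLp.sndL 2 ℂ H K))
  map_one' := by
    refine ContinuousLinearMap.ext fun x => WithLp.ofLp_injective 2 ?_
    ext <;> simp
  map_mul' p q := by
    refine ContinuousLinearMap.ext fun x => WithLp.ofLp_injective 2 ?_
    ext <;> simp
  map_zero' := by
    refine ContinuousLinearMap.ext fun x => WithLp.ofLp_injective 2 ?_
    ext <;> simp
  map_add' p q := by
    refine ContinuousLinearMap.ext fun x => WithLp.ofLp_injective 2 ?_
    ext <;> simp
  commutes' r := by
    refine ContinuousLinearMap.ext fun x => WithLp.ofLp_injective 2 ?_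
    ext <;> simp [Algebra.algebraMap_eq_smul_one]

/-- `U` is a homomorphism of `A_d`-modules. -/
def IsModuleHom {d : ℕ} {H K : Type*} [NormedAddCommGroup H] [InnerProductSpace ℂ H]
    [NormedAddCommGroup K] [InnerProductSpace ℂ K]
    (ρ : HilbertModule d H) (σ : HilbertModule d K) (U : H → K) : Prop :=
  ∀ (p : MvPolynomial (Fin d) ℂ) (x : H), U (ρ p x) = σ p (U x)

/-- `N` is a submodule (invariant under all polynomials). -/
def IsSubmodule {d : ℕ} {H : Type*} [NormedAddCommGroup H] [InnerProductSpace ℂ H]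
    (ρ : HilbertModule d H) (N : Submodule ℂ H) : Prop :=
  ∀ (p : MvPolynomial (Fin d) ℂ), ∀ x ∈ N, ρ p x ∈ N

/-- `(F, S, U)` is a minimal dilation of the module `ρ`, where `F` is the free module of rank `ι`
and `S` is the spherical module of `π`: the map `U : F ⊕ S → H` is a coisometric module
homomorphism, and the closed submodule generated by `U* H` is all of `F ⊕ S`. -/
structure IsMinimalDilation {d : ℕ} {H : Type*} [NormedAddCommGroup H] [InnerProductSpace ℂ H]
    [CompleteSpace H] (ρ : HilbertModule d H) (ι : Type*) {K : Type*} [NormedAddCommGroup K]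
    [InnerProductSpace ℂ K] [CompleteSpace K] (π : C(Sphere d, ℂ) →⋆ₐ[ℂ] (K →L[ℂ] K))
    (U : WithLp 2 (Free d ι × K) →L[ℂ] H) : Prop where
  isModuleHom : IsModuleHom (directSum (freeModule d ι) (sphericalModule π)) ρ U
  coisometry : U ∘L U.adjoint = ContinuousLinearMap.id ℂ H
  minimal : ∀ N : Submodule ℂ (WithLp 2 (Free d ι × K)), IsClosed (N : Set (WithLp 2 (Free d ι × K))) →
    IsSubmodule (directSum (freeModule d ι) (sphericalModule π)) N →
    (∀ x : H, U.adjoint x ∈ N) → N = ⊤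

/-- `ρ` is unitarily isomorphic to the quotient of a free module by a closed submodule `N`; the
quotient `F ⧸ N` carries the quotient (Hilbert space) norm and the action `p • [x] = [p • x]`. -/
def IsQuotientOfFree {d : ℕ} {H : Type u} [NormedAddCommGroup H] [InnerProductSpace ℂ H]
    (ρ : HilbertModule d H) : Prop :=
  ∃ (ι : Type u) (N : Submodule ℂ (Free d ι)), IsClosed (N : Set (Free d ι)) ∧
    IsSubmodule (freeModule d ι) N ∧
    ∃ V : (Free d ι ⧸ N) ≃ₗᵢ[ℂ] H, ∀ (p : MvPolynomial (Fin d) ℂ) (x : Free d ι),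
      V (Submodule.Quotient.mk (freeModule d ι p x)) = ρ p (V (Submodule.Quotient.mk x))

/-- Purity of a contractive module, in both of its (equivalent) formulations: the spherical part
of any minimal dilation is trivial, and the module is unitarily isomorphic to a quotient of a free
module. -/
structure IsPure {d : ℕ} {H : Type u} [NormedAddCommGroup H] [InnerProductSpace ℂ H]
    [CompleteSpace H] (ρ : HilbertModule d H) : Prop where
  spherical_part_trivial : ∀ (ι K : Type u) [NormedAddCommGroup K] [InnerProductSpace ℂ K]
    [CompleteSpace K] (π : C(Sphere d, ℂ) →⋆ₐ[ℂ] (K →L[ℂ] K))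
    (U : WithLp 2 (Free d ι × K) →L[ℂ] H), IsMinimalDilation ρ ι π U → Subsingleton K
  isQuotientOfFree : IsQuotientOfFree ρ

/-! ## Möbius transforms -/

/-- `φ` restricts to a Möbius transform of the closed unit ball of `ℂ^d`: a continuous bijection
of the closed ball onto itself that is holomorphic in the open ball and maps the open ball onto
itself and the sphere onto itself.  (The values of `φ` off the closed ball are irrelevant.) -/
structure IsMobius {d : ℕ} (φ : EuclideanSpace ℂ (Fin d) → EuclideanSpace ℂ (Fin d)) : Prop where
  continuousOn : ContinuousOn φ (Metric.closedBall 0 1)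
  bijOn : Set.BijOn φ (Metric.closedBall 0 1) (Metric.closedBall 0 1)
  holomorphic : DifferentiableOn ℂ φ (Metric.ball 0 1)
  image_ball : φ '' Metric.ball 0 1 = Metric.ball 0 1
  image_sphere : φ '' Metric.sphere 0 1 = Metric.sphere 0 1

/-- The restriction of a Möbius transform to the open ball. -/
def IsMobius.onBall {d : ℕ} {φ : EuclideanSpace ℂ (Fin d) → EuclideanSpace ℂ (Fin d)}
    (hφ : IsMobius φ) (z : Ball d) : Ball d :=
  ⟨φ z, hφ.image_ball.subset (Set.mem_image_of_mem φ z.2)⟩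

/-- `ρ` is the module `(H_d^2)_φ`: the `A_d`-module structure on the Hilbert space `H_d^2` in which
`z_i` acts as multiplication by the `i`-th coordinate function of `φ`. -/
def IsMobiusModule {d : ℕ} (φ : EuclideanSpace ℂ (Fin d) → EuclideanSpace ℂ (Fin d))
    (ρ : HilbertModule d (H2 d)) : Prop :=
  ∀ (i : Fin d) (ξ : H2 d) (z : Ball d), ρ (MvPolynomial.X i) ξ z = φ z i * ξ z

/-- There is at most one such module structure, so `(H_d^2)_φ` is well defined if it exists. -/
lemma IsMobiusModule.unique {d : ℕ}
    {φ : EuclideanSpace ℂ (Fin d) → EuclideanSpace ℂ (Fin d)}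
    {ρ σ : HilbertModule d (H2 d)} (hρ : IsMobiusModule φ ρ) (hσ : IsMobiusModule φ σ) :
    ρ = σ := by
  refine MvPolynomial.algHom_ext fun i => ?_
  refine ContinuousLinearMap.ext fun ξ => RKHS.ext (H := H2 d) fun z => ?_
  rw [hρ i ξ z, hσ i ξ z]

end HilbertModules

end

open HilbertModules

namespace HilbertModules

open Metric Set Filter Topology

/-! Everything rests on an identity `1 - ⟨φ z, φ w⟩ = q z * conj (q w) * (1 - ⟨z, w⟩)` on the ball.
Putting `w = λ` shows that `q` is a unimodular multiple of `m = k_λ / ‖k_λ‖`. Hence the vectors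
`conj (m w) • k_{φ w}` have the same Gram matrix as the `k_w`, and `U_φ` is unitary
(`exists_weightedComposition`). The module is then `H_d^2` conjugated by `U_φ`, so it inherits
contractivity and is free of rank one. A minimal dilation has no spherical part because the kernel
functions are joint eigenvectors of the adjoint coordinates, with eigenvalue vectors of norm `< 1`,
whereas on a spherical module `∑ S_i S_i* = 1` (`subsingleton_of_isMinimalDilation`).

For the involutions exchanging `a` and `0` the identity is a computation. Composing `φ` with two of
them gives a map fixing the origin, which Cartan's theorem shows to be a linear isometry
(`exists_linearIsometry_eqOn`). Cartan's theorem needs the Schwarz lemma for the inverse too, but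
compactness only makes the inverse `ψ` continuous. It is holomorphic where `det φ' (ψ w) ≠ 0`, a set
which is dense by Sard. The Schwarz lemma survives with this determinant as a weight vanishing on
the bad set (`norm_le_norm_of_weight`). -/

/-! ## Rigidity of holomorphic bijections of the ball -/

/-- A form of the Schwarz lemma for a function which is holomorphic only off the zero set of a
weight `h`. -/
theorem norm_le_norm_of_weight {g h : ℂ → ℂ} (hg : ContinuousOn g (ball 0 1))
    (hh : ContinuousOn h (ball 0 1))
    (hgd : ∀ t ∈ ball (0 : ℂ) 1, h t ≠ 0 → DifferentiableAt ℂ g t)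
    (hhd : ∀ t ∈ ball (0 : ℂ) 1, h t ≠ 0 → DifferentiableAt ℂ h t)
    (hg0 : g 0 = 0) (hh0 : h 0 ≠ 0) (hb : ∀ t ∈ ball (0 : ℂ) 1, ‖g t‖ ≤ 1)
    {t : ℂ} (ht : t ∈ ball (0 : ℂ) 1) (hht : h t ≠ 0) : ‖g t‖ ≤ ‖t‖ := by
  have h0 : (0 : ℂ) ∈ ball (0 : ℂ) 1 := mem_ball_self one_pos
  set u := dslope g 0 with hu
  have hgu : ∀ z, z * u z = g z := fun z => by
    have := sub_smul_dslope g 0 z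
    simpa [hg0] using this
  have huc : ContinuousOn u (ball 0 1) :=
    (continuousOn_dslope (isOpen_ball.mem_nhds h0)).2 ⟨hg, hgd 0 h0 hh0⟩
  set Ω := {z ∈ ball (0 : ℂ) 1 | h z ≠ 0} with hΩ
  have hΩo : IsOpen Ω := hh.isOpen_inter_preimage isOpen_ball isOpen_ne
  have hud : DifferentiableOn ℂ u Ω :=
    (Complex.differentiableOn_dslope (hΩo.mem_nhds ⟨h0, hh0⟩)).2
      fun z hz => (hgd z hz.1 hz.2).differentiableWithinAt
  have key : ∀ r ∈ Ioo ‖t‖ 1, ‖u t‖ * r ≤ 1 := by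
    rintro r ⟨htr, hr1⟩
    have hr0 : 0 < r := (norm_nonneg t).trans_lt htr
    have hsub : closedBall (0 : ℂ) r ⊆ ball 0 1 := closedBall_subset_ball hr1
    obtain ⟨C, hC⟩ := (isCompact_closedBall (0 : ℂ) r).exists_bound_of_continuousOn
      (hh.mono hsub)
    -- Maximum principle for `u ^ n * h` off the zeros of `h`: boundary points inside the disc are
    -- zeros of `h` and contribute nothing. The bound `C` does not depend on `n`, so large powers
    -- make the weight irrelevant.
    have hbd : ∀ n : ℕ, (‖u t‖ * r) ^ n * ‖h t‖ ≤ C := by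
      intro n
      set U := Ω ∩ ball 0 r with hU
      have hUc : closure U ⊆ closedBall 0 r :=
        closure_minimal (inter_subset_right.trans ball_subset_closedBall) isClosed_closedBall
      have hd : DiffContOnCl ℂ (fun z => u z ^ n * h z) U := by
        refine ⟨?_, ?_⟩
        · refine ((hud.mono inter_subset_left).pow n).mul fun z hz => ?_
          exact (hhd z hz.1.1 hz.1.2).differentiableWithinAt
        · exact ((huc.pow n).mul hh).mono (hUc.trans hsub)
      have hC0 : 0 ≤ C := (norm_nonneg _).trans (hC 0 (mem_closedBall_self hr0.le))
      have hfr : ∀ z ∈ frontier U, ‖u z ^ n * h z‖ ≤ (1 / r) ^ n * C := by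
        intro z hz
        rw [(hΩo.inter isOpen_ball).frontier_eq] at hz
        have hzr := hUc hz.1
        rcases (mem_closedBall_zero_iff.1 hzr).lt_or_eq with hlt | heq
        · have : h z = 0 := by
            by_contra hne
            exact hz.2 ⟨⟨hsub hzr, hne⟩, mem_ball_zero_iff.2 hlt⟩
          rw [this, mul_zero, norm_zero]
          positivity
        · rw [norm_mul, norm_pow]
          have h1 : ‖u z‖ ≤ 1 / r := by
            rw [le_div_iff₀ hr0, mul_comm, ← heq, ← norm_mul, hgu]
            exact hb z (hsub hzr)
          gcongr
          exact hC z hzr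
      have := Complex.norm_le_of_forall_mem_frontier_norm_le
        (isBounded_ball.subset inter_subset_right) hd hfr
        (subset_closure ⟨⟨ht, hht⟩, mem_ball_zero_iff.2 htr⟩)
      rw [norm_mul, norm_pow] at this
      calc (‖u t‖ * r) ^ n * ‖h t‖ = ‖u t‖ ^ n * ‖h t‖ * r ^ n := by rw [mul_pow]; ring
        _ ≤ (1 / r) ^ n * C * r ^ n := by gcongr
        _ = C := by rw [div_pow, one_pow]; field_simp
    by_contra! hlt
    obtain ⟨n, hn⟩ := pow_unbounded_of_one_lt (C / ‖h t‖) hlt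
    rw [div_lt_iff₀ (norm_pos_iff.2 hht)] at hn
    exact absurd (hbd n) (not_le.2 hn)
  have hu1 : ‖u t‖ ≤ 1 := by
    have ht1 : ‖t‖ < 1 := mem_ball_zero_iff.1 ht
    have hlim : Tendsto (fun r : ℝ => ‖u t‖ * r) (𝓝[<] 1) (𝓝 (‖u t‖ * 1)) :=
      (tendsto_id.const_mul _).mono_left nhdsWithin_le_nhds
    rw [mul_one] at hlim
    exact le_of_tendsto hlim (by filter_upwards [Ioo_mem_nhdsLT ht1] using key)
  rw [← hgu, norm_mul]
  exact mul_le_of_le_one_right (norm_nonneg _) hu1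

/-! ### Regularity of the derivative of a bounded holomorphic map -/

section Regularity

variable {E G : Type*} [NormedAddCommGroup E] [NormedSpace ℂ E] [NormedAddCommGroup G]
  [NormedSpace ℂ G] {F : E → G}

/-- Higher-order Schwarz lemma for `F` minus its linear part at `z`, which differs from its value at
`z` by `o(‖y - z‖)`. The constant is `4 = 1 + 1 + 2`: two values of `F`, and the linear part, which
Cauchy's estimate bounds by `2 / r * r`. -/
lemma norm_sub_sub_fderiv_le (hF : DifferentiableOn ℂ F (ball 0 1))
    (hb : ∀ z ∈ ball 0 1, ‖F z‖ ≤ 1) {z w : E} {r : ℝ} (hr : ball z r ⊆ ball 0 1)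
    (hw : w ∈ ball z r) :
    ‖F w - F z - fderiv ℂ F z (w - z)‖ ≤ 4 * (dist w z / r) ^ 2 := by
  have hr0 : 0 < r := nonempty_ball.mp ⟨_, hw⟩
  have hz : z ∈ ball (0 : E) 1 := hr (mem_ball_self hr0)
  have hFz : DifferentiableAt ℂ F z := hF.differentiableAt (isOpen_ball.mem_nhds hz)
  have h1 : ‖fderiv ℂ F z‖ ≤ 2 / r := by
    refine Complex.norm_fderiv_le_div_of_mapsTo_ball (hF.mono hr) (fun y hy => ?_) hr0
    rw [mem_closedBall, dist_eq_norm]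
    calc _ ≤ ‖F y‖ + ‖F z‖ := norm_sub_le _ _
      _ ≤ 2 := by linarith [hb y (hr hy), hb z hz]
  have h2 := Complex.dist_le_mul_div_pow_of_mapsTo_ball_of_isLittleO
    (f := fun y => F y - fderiv ℂ F z (y - z)) (c := z) (z := w) (R₁ := r) (R₂ := 4) (n := 1)
    ((hF.mono hr).sub (by fun_prop)) (fun y hy => ?_) ?_ hw
  · rw [dist_eq_norm] at h2
    simp only [sub_self, map_zero, sub_zero] at h2
    rwa [sub_right_comm] at h2
  · rw [mem_closedBall, dist_eq_norm]
    have h3 : ‖fderiv ℂ F z (y - z)‖ ≤ 2 := by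
      refine (ContinuousLinearMap.le_opNorm _ _).trans ?_
      have : ‖y - z‖ < r := by rwa [mem_ball, dist_eq_norm] at hy
      calc _ ≤ 2 / r * r := by gcongr
        _ = 2 := by field_simp
    simp only [sub_self, map_zero, sub_zero]
    calc _ ≤ ‖F y‖ + ‖fderiv ℂ F z (y - z)‖ + ‖F z‖ :=
          (norm_sub_le _ _).trans (by gcongr; exact norm_sub_le _ _)
      _ ≤ 4 := by linarith [hb y (hr hy), hb z hz]
  · have := hFz.hasFDerivAt.isLittleO
    simp only [pow_one]
    refine (this.norm_right).congr_left fun y => ?_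
    simp
    abel

/-- The quadratic remainder is uniform on smaller balls, since every point there has room `1 - r`.
Uniform limits then pass continuity, and holomorphy along curves, from `F` to its directional
derivatives. -/
lemma tendstoUniformlyOn_fderiv (hF : DifferentiableOn ℂ F (ball 0 1))
    (hb : ∀ z ∈ ball 0 1, ‖F z‖ ≤ 1) {r : ℝ} (hr : r < 1) (v : E) :
    TendstoUniformlyOn (fun (s : ℂ) z => s⁻¹ • (F (z + s • v) - F z))
      (fun z => fderiv ℂ F z v) (𝓝[≠] 0) (ball 0 r) := by
  rw [Metric.tendstoUniformlyOn_iff]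
  intro ε hε
  have hr' : 0 < 1 - r := by linarith
  have h1 : Tendsto (fun s : ℂ => ‖s‖ * ‖v‖) (𝓝[≠] 0) (𝓝 0) := by
    have : Tendsto (fun s : ℂ => ‖s‖ * ‖v‖) (𝓝 0) (𝓝 (‖(0 : ℂ)‖ * ‖v‖)) := by
      apply Continuous.tendsto; fun_prop
    simpa using this.mono_left nhdsWithin_le_nhds
  have h2 : Tendsto (fun s : ℂ => 4 * ‖s‖ * (‖v‖ / (1 - r)) ^ 2) (𝓝[≠] 0) (𝓝 0) := by
    have : Tendsto (fun s : ℂ => 4 * ‖s‖ * (‖v‖ / (1 - r)) ^ 2) (𝓝 0)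
        (𝓝 (4 * ‖(0 : ℂ)‖ * (‖v‖ / (1 - r)) ^ 2)) := by
      apply Continuous.tendsto; fun_prop
    simpa using this.mono_left nhdsWithin_le_nhds
  filter_upwards [h1.eventually_lt_const hr', h2.eventually_lt_const hε, self_mem_nhdsWithin]
    with s hs1 hs2 hs0 z hz
  have hs : 0 < ‖s‖ := norm_pos_iff.2 hs0
  have hsub : ball z (1 - r) ⊆ ball (0 : E) 1 := by
    refine ball_subset_ball' ?_
    rw [dist_zero_right]
    linarith [mem_ball_zero_iff.1 hz]
  have h3 := norm_sub_sub_fderiv_le hF hb hsub (w := z + s • v)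
    (by rw [mem_ball, dist_eq_norm, add_sub_cancel_left, norm_smul]; exact hs1)
  rw [dist_comm, dist_eq_norm]
  have h4 : s⁻¹ • (F (z + s • v) - F z) - fderiv ℂ F z v
      = s⁻¹ • (F (z + s • v) - F z - fderiv ℂ F z (z + s • v - z)) := by
    rw [add_sub_cancel_left, map_smul, smul_sub (s⁻¹) _ (s • _), smul_smul, inv_mul_cancel₀ hs0,
      one_smul]
  rw [h4, norm_smul, norm_inv]
  refine lt_of_le_of_lt ?_ hs2
  rw [inv_mul_le_iff₀ hs]
  refine h3.trans (le_of_eq ?_)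
  rw [dist_eq_norm, add_sub_cancel_left, norm_smul]
  ring

lemma exists_mem_ball_lt {E : Type*} [NormedAddCommGroup E] {z : E} (hz : z ∈ ball (0 : E) 1) : ∃ r < 1, z ∈ ball (0 : E) r := by
  obtain ⟨r, h1, h2⟩ := exists_between (mem_ball_zero_iff.1 hz)
  exact ⟨r, h2, mem_ball_zero_iff.2 h1⟩

lemma eventually_mapsTo_add_smul {r : ℝ} (hr : r < 1) (v : E) :
    ∀ᶠ s : ℂ in 𝓝[≠] 0, MapsTo (fun z => z + s • v) (ball (0 : E) r) (ball 0 1) := by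
  have h1 : Tendsto (fun s : ℂ => ‖s‖ * ‖v‖) (𝓝[≠] 0) (𝓝 0) := by
    have : Tendsto (fun s : ℂ => ‖s‖ * ‖v‖) (𝓝 0) (𝓝 (‖(0 : ℂ)‖ * ‖v‖)) := by
      apply Continuous.tendsto; fun_prop
    simpa using this.mono_left nhdsWithin_le_nhds
  filter_upwards [h1.eventually_lt_const (sub_pos.2 hr)] with s hs z hz
  rw [mem_ball_zero_iff] at hz ⊢
  calc _ ≤ ‖z‖ + ‖s • v‖ := norm_add_le _ _
    _ < 1 := by rw [norm_smul]; linarith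

lemma continuousOn_fderiv_apply (hF : DifferentiableOn ℂ F (ball 0 1))
    (hb : ∀ z ∈ ball 0 1, ‖F z‖ ≤ 1) (v : E) :
    ContinuousOn (fun z => fderiv ℂ F z v) (ball 0 1) := by
  intro z hz
  obtain ⟨r, hr, hzr⟩ := exists_mem_ball_lt hz
  refine ((ContinuousOn.continuousAt ?_ (isOpen_ball.mem_nhds hzr))).continuousWithinAt
  refine (tendstoUniformlyOn_fderiv hF hb hr v).continuousOn (Eventually.frequently ?_)
  filter_upwards [eventually_mapsTo_add_smul hr v] with s hs
  refine continuousOn_const.smul (ContinuousOn.sub ?_ ?_)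
  · exact hF.continuousOn.comp (by fun_prop) hs
  · exact hF.continuousOn.mono (ball_subset_ball hr.le)

lemma differentiableOn_fderiv_apply_comp [CompleteSpace G] (hF : DifferentiableOn ℂ F (ball 0 1))
    (hb : ∀ z ∈ ball 0 1, ‖F z‖ ≤ 1) (v : E) {γ : ℂ → E} {V : Set ℂ} (hV : IsOpen V)
    (hγ : DifferentiableOn ℂ γ V) (hγm : MapsTo γ V (ball 0 1)) :
    DifferentiableOn ℂ (fun t => fderiv ℂ F (γ t) v) V := by
  intro t ht
  obtain ⟨r, hr, hzr⟩ := exists_mem_ball_lt (hγm ht)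
  have hW : IsOpen (V ∩ γ ⁻¹' ball 0 r) := hγ.continuousOn.isOpen_inter_preimage hV isOpen_ball
  refine (DifferentiableOn.differentiableAt ?_
    (hW.mem_nhds ⟨ht, hzr⟩)).differentiableWithinAt
  have hm : MapsTo γ (V ∩ γ ⁻¹' ball 0 r) (ball 0 r) := fun t ht => ht.2
  have hlim := (((tendstoUniformlyOn_fderiv hF hb hr v).comp γ).mono
    hm).tendstoLocallyUniformlyOn
  refine hlim.differentiableOn ?_ hW
  filter_upwards [eventually_mapsTo_add_smul hr v] with s hs
  have hγ' := hγ.mono (inter_subset_left (t := γ ⁻¹' ball 0 r))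
  refine DifferentiableOn.const_smul (DifferentiableOn.sub ?_ ?_) _
  · exact hF.comp (hγ'.add_const _) (hs.comp hm)
  · exact hF.comp hγ' (hm.mono_right (ball_subset_ball hr.le))

end Regularity

/-! ### The Jacobian determinant -/

section Det

variable {E : Type*} [NormedAddCommGroup E] [NormedSpace ℂ E] [FiniteDimensional ℂ E] {F : E → E}

lemma det_eq_sum (A : E →L[ℂ] E) : A.det =
    ∑ σ : Equiv.Perm (Fin (Module.finrank ℂ E)), (Equiv.Perm.sign σ : ℂ) *
      ∏ i, (Module.finBasis ℂ E).coord (σ i) (A (Module.finBasis ℂ E i)) := by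
  rw [ContinuousLinearMap.det, ← LinearMap.det_toMatrix (Module.finBasis ℂ E), Matrix.det_apply']
  simp [LinearMap.toMatrix_apply]

lemma continuousOn_det_fderiv (hF : DifferentiableOn ℂ F (ball 0 1))
    (hb : ∀ z ∈ ball 0 1, ‖F z‖ ≤ 1) :
    ContinuousOn (fun z => (fderiv ℂ F z).det) (ball 0 1) := by
  simp only [det_eq_sum]
  refine continuousOn_finsetSum _ fun σ _ => continuousOn_const.mul
    (continuousOn_finsetProd _ fun i _ => ?_)
  exact (LinearMap.continuous_of_finiteDimensional _).comp_continuousOn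
    (continuousOn_fderiv_apply hF hb _)

lemma differentiableOn_det_fderiv_comp (hF : DifferentiableOn ℂ F (ball 0 1))
    (hb : ∀ z ∈ ball 0 1, ‖F z‖ ≤ 1) {γ : ℂ → E} {V : Set ℂ} (hV : IsOpen V)
    (hγ : DifferentiableOn ℂ γ V) (hγm : MapsTo γ V (ball 0 1)) :
    DifferentiableOn ℂ (fun t => (fderiv ℂ F (γ t)).det) V := by
  have : CompleteSpace E := FiniteDimensional.complete ℂ E
  simp only [det_eq_sum]
  refine DifferentiableOn.fun_sum fun σ _ => DifferentiableOn.const_mul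
    (DifferentiableOn.fun_finsetProd fun i _ => ?_) _
  exact ((LinearMap.toContinuousLinearMap ((Module.finBasis ℂ E).coord (σ i))).differentiable
    ).comp_differentiableOn (differentiableOn_fderiv_apply_comp hF hb _ hV hγ hγm)

end Det

/-! ### Schwarz lemma for the inverse, and Cartan's theorem -/

section Inverse

variable {E : Type*} [NormedAddCommGroup E] [InnerProductSpace ℂ E] [FiniteDimensional ℂ E]
  {F ψ : E → E}

/-- The values at which the inverse is known to be differentiable are dense. -/
lemma dense_det_ne_zero (hF : DifferentiableOn ℂ F (ball 0 1)) (hψm : MapsTo ψ (ball 0 1) (ball 0 1))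
    (hright : ∀ w ∈ ball 0 1, F (ψ w) = w) :
    ball (0 : E) 1 ⊆ closure {w ∈ ball (0 : E) 1 | (fderiv ℂ F (ψ w)).det ≠ 0} := by
  borelize E
  set s := {z ∈ ball (0 : E) 1 | (fderiv ℂ F z).det = 0} with hs
  -- The easy case of Sard's theorem: the critical values form a null set, so they contain no
  -- nonempty open set.
  have hnull : (MeasureTheory.Measure.addHaar : MeasureTheory.Measure E) (F '' s) = 0 := by
    refine MeasureTheory.addHaar_image_eq_zero_of_det_fderivWithin_eq_zero
      (f' := fun z => (fderiv ℂ F z).restrictScalars ℝ) _ (fun z hz => ?_) fun z hz => ?_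
    · exact ((hF.differentiableAt (isOpen_ball.mem_nhds hz.1)).hasFDerivAt.restrictScalars
        ℝ).hasFDerivWithinAt
    -- The measure statement concerns the real determinant. If that were nonzero the derivative
    -- would be injective, and its complex determinant would be a unit.
    · by_contra hne
      have hinj : Function.Injective (fderiv ℂ F z) :=
        (((fderiv ℂ F z).restrictScalars ℝ).toContinuousLinearEquivOfDetNeZero hne).injective
      have hu : IsUnit (fderiv ℂ F z : E →ₗ[ℂ] E) :=
        (LinearMap.isUnit_iff_ker_eq_bot _).2 (LinearMap.ker_eq_bot.2 hinj)
      exact ((LinearMap.isUnit_iff_isUnit_det _).1 hu).ne_zero hz.2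
  intro w hw
  rw [_root_.mem_closure_iff]
  intro O hO hwO
  by_contra hcon
  have hsub : O ∩ ball 0 1 ⊆ F '' s := by
    rintro x ⟨hxO, hx⟩
    refine ⟨ψ x, ⟨hψm hx, ?_⟩, hright x hx⟩
    by_contra hne
    exact hcon ⟨x, hxO, hx, hne⟩
  exact ((hO.inter isOpen_ball).measure_pos MeasureTheory.Measure.addHaar ⟨w, hwO, hw⟩).ne'
    (MeasureTheory.measure_mono_null hsub hnull)

lemma differentiableAt_inverse (hF : DifferentiableOn ℂ F (ball 0 1))
    (hψ : ContinuousOn ψ (ball 0 1)) (hψm : MapsTo ψ (ball 0 1) (ball 0 1))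
    (hright : ∀ w ∈ ball 0 1, F (ψ w) = w) {w : E} (hw : w ∈ ball 0 1)
    (hd : (fderiv ℂ F (ψ w)).det ≠ 0) : DifferentiableAt ℂ ψ w := by
  have hFd := (hF.differentiableAt (isOpen_ball.mem_nhds (hψm hw))).hasFDerivAt
  rw [← ContinuousLinearMap.coe_toContinuousLinearEquivOfDetNeZero _ hd] at hFd
  refine (HasFDerivAt.of_local_left_inverse (hψ.continuousAt (isOpen_ball.mem_nhds hw))
    hFd ?_).differentiableAt
  filter_upwards [isOpen_ball.mem_nhds hw] using hright

/-- The weighted Schwarz lemma is applied on each complex line through the origin, with weight `det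
F'` evaluated at `ψ`. Differentiability of `ψ` at the origin is what makes the weight nonzero there.
-/
theorem norm_inverse_le (hF : DifferentiableOn ℂ F (ball 0 1))
    (hFm : MapsTo F (ball 0 1) (ball 0 1))
    (hψ : ContinuousOn ψ (ball 0 1)) (hψm : MapsTo ψ (ball 0 1) (ball 0 1))
    (hleft : ∀ z ∈ ball 0 1, ψ (F z) = z) (hright : ∀ w ∈ ball 0 1, F (ψ w) = w)
    (hF0 : F 0 = 0) (hd0 : DifferentiableAt ℂ ψ 0) :
    ∀ w ∈ ball (0 : E) 1, ‖ψ w‖ ≤ ‖w‖ := by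
  have h0 : (0 : E) ∈ ball (0 : E) 1 := mem_ball_self one_pos
  have hψ0 : ψ 0 = 0 := by simpa [hF0] using hleft 0 h0
  have hFb : ∀ z ∈ ball (0 : E) 1, ‖F z‖ ≤ 1 := fun z hz => (mem_ball_zero_iff.1 (hFm hz)).le
  set D : E → ℂ := fun z => (fderiv ℂ F z).det with hD
  have hDc : ContinuousOn D (ball 0 1) := continuousOn_det_fderiv hF hFb
  have hD0 : D 0 ≠ 0 := by
    have h1 : HasFDerivAt (ψ ∘ F) ((fderiv ℂ ψ 0).comp (fderiv ℂ F 0)) 0 := by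
      refine HasFDerivAt.comp _ ?_ (hF.differentiableAt (isOpen_ball.mem_nhds h0)).hasFDerivAt
      rw [hF0]
      exact hd0.hasFDerivAt
    have h2 : HasFDerivAt (ψ ∘ F) (ContinuousLinearMap.id ℂ E) 0 := by
      refine (hasFDerivAt_id 0).congr_of_eventuallyEq ?_
      filter_upwards [isOpen_ball.mem_nhds h0] with z hz using hleft z hz
    have h3 : LinearMap.det ((fderiv ℂ ψ 0 : E →ₗ[ℂ] E) ∘ₗ (fderiv ℂ F 0 : E →ₗ[ℂ] E)) = 1 :=
      (congrArg (fun A : E →L[ℂ] E => LinearMap.det (A : E →ₗ[ℂ] E)) (h1.unique h2)).trans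
        LinearMap.det_id
    rw [LinearMap.det_comp] at h3
    exact right_ne_zero_of_mul_eq_one h3
  have key : ∀ w ∈ {w ∈ ball (0 : E) 1 | D (ψ w) ≠ 0}, ‖ψ w‖ ≤ ‖w‖ := by
    rintro w ⟨hw, hDw⟩
    rcases eq_or_ne w 0 with rfl | hw0
    · simp [hψ0]
    have hwn : (‖w‖ : ℂ) ≠ 0 := by simpa using hw0
    set ζ : E := (‖w‖ : ℂ)⁻¹ • w with hζ
    have hζ1 : ‖ζ‖ = 1 := by
      rw [hζ, norm_smul, norm_inv, Complex.norm_real, norm_norm, inv_mul_cancel₀ (by simpa using hw0)]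
    have hζm : MapsTo (fun t : ℂ => t • ζ) (ball 0 1) (ball 0 1) := fun t ht => by
      rw [mem_ball_zero_iff] at ht ⊢
      rwa [norm_smul, hζ1, mul_one]
    have hζw : (‖w‖ : ℂ) • ζ = w := by rw [hζ, smul_smul, mul_inv_cancel₀ hwn, one_smul]
    -- A functional norming `ψ w` reduces the estimate to a scalar function of one variable.
    obtain ⟨f, hf1, hfw⟩ := exists_dual_vector'' ℂ (ψ w)
    have hγc : ContinuousOn (fun t : ℂ => ψ (t • ζ)) (ball 0 1) := hψ.comp (by fun_prop) hζm
    have hγm : MapsTo (fun t : ℂ => ψ (t • ζ)) (ball 0 1) (ball 0 1) := hψm.comp hζm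
    have hhc : ContinuousOn (fun t : ℂ => D (ψ (t • ζ))) (ball 0 1) := hDc.comp hγc hγm
    have hγd : ∀ t ∈ ball (0 : ℂ) 1, D (ψ (t • ζ)) ≠ 0 →
        DifferentiableAt ℂ (fun t : ℂ => ψ (t • ζ)) t := fun t ht htD =>
      (differentiableAt_inverse hF hψ hψm hright (hζm ht) htD).comp t
        (differentiableAt_id.smul_const ζ)
    have hVo : IsOpen {t ∈ ball (0 : ℂ) 1 | D (ψ (t • ζ)) ≠ 0} :=
      hhc.isOpen_inter_preimage isOpen_ball isOpen_ne
    have hhd := differentiableOn_det_fderiv_comp hF hFb hVo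
      (fun t ht => (hγd t ht.1 ht.2).differentiableWithinAt) (hγm.mono_left (sep_subset _ _))
    have := norm_le_norm_of_weight (g := fun t => f (ψ (t • ζ))) (h := fun t => D (ψ (t • ζ)))
      (f.continuous.comp_continuousOn hγc) hhc
      (fun t ht htD => f.differentiableAt.comp t (hγd t ht htD))
      (fun t ht htD => hhd.differentiableAt (hVo.mem_nhds ⟨ht, htD⟩))
      (by simp [hψ0]) (by simpa [hψ0] using hD0)
      (fun t ht => (f.le_of_opNorm_le hf1 _).trans
        (by simpa using (mem_ball_zero_iff.1 (hγm ht)).le))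
      (t := ‖w‖) (by simpa using hw) (by rwa [hζw])
    simpa [hζw, hfw] using this
  intro w hw
  -- The exceptional points are reached by density and continuity of `ψ`.
  have hcl := dense_det_ne_zero hF hψm hright hw
  have hcw : ContinuousWithinAt (fun w => ‖ψ w‖) {w ∈ ball (0 : E) 1 | D (ψ w) ≠ 0} w :=
    ((hψ w hw).mono (sep_subset _ _)).norm
  exact hcw.closure_le hcl continuous_norm.continuousWithinAt key

/-- Cartan's uniqueness theorem for bijections of the ball fixing the origin. -/
theorem exists_linearIsometry_eqOn (hF : DifferentiableOn ℂ F (ball 0 1))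
    (hFm : MapsTo F (ball 0 1) (ball 0 1))
    (hψ : ContinuousOn ψ (ball 0 1)) (hψm : MapsTo ψ (ball 0 1) (ball 0 1))
    (hleft : ∀ z ∈ ball 0 1, ψ (F z) = z) (hright : ∀ w ∈ ball 0 1, F (ψ w) = w)
    (hF0 : F 0 = 0) (hd0 : DifferentiableAt ℂ ψ 0) :
    ∃ A : E →ₗᵢ[ℂ] E, EqOn F A (ball 0 1) := by
  have : CompleteSpace E := FiniteDimensional.complete ℂ E
  -- Strict convexity is needed for the equality case of the vector-valued Schwarz lemma.
  have hconv : StrictConvexSpace ℝ E := by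
    let _ : InnerProductSpace ℝ E := InnerProductSpace.rclikeToReal ℂ E
    infer_instance
  have h0 : (0 : E) ∈ ball (0 : E) 1 := mem_ball_self one_pos
  have hnorm : ∀ z ∈ ball (0 : E) 1, ‖F z‖ = ‖z‖ := by
    intro z hz
    refine le_antisymm ?_ ?_
    · exact Complex.norm_le_norm_of_mapsTo_ball hF (hFm.mono_right ball_subset_closedBall) hF0
        (mem_ball_zero_iff.1 hz)
    · simpa [hleft z hz] using norm_inverse_le hF hFm hψ hψm hleft hright hF0 hd0 _ (hFm hz)
  -- Norm preservation is equality in Schwarz on every complex disc through `0`, so `t ↦ F (t • ζ)`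
  -- is `t • C`, and `C` must be the derivative in direction `ζ`.
  have hhom : ∀ z ∈ ball (0 : E) 1, ‖fderiv ℂ F 0 z‖ = ‖z‖ ∧ F z = fderiv ℂ F 0 z := by
    intro w hw
    rcases eq_or_ne w 0 with rfl | hw0
    · simp [hF0]
    have hwn : (‖w‖ : ℂ) ≠ 0 := by simpa using hw0
    set ζ : E := (‖w‖ : ℂ)⁻¹ • w with hζ
    have hζ1 : ‖ζ‖ = 1 := by
      rw [hζ, norm_smul, norm_inv, Complex.norm_real, norm_norm, inv_mul_cancel₀ (by simpa using hw0)]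
    have hζm : MapsTo (fun t : ℂ => t • ζ) (ball 0 1) (ball 0 1) := fun t ht => by
      rw [mem_ball_zero_iff] at ht ⊢
      rwa [norm_smul, hζ1, mul_one]
    have hζw : (‖w‖ : ℂ) • ζ = w := by rw [hζ, smul_smul, mul_inv_cancel₀ hwn, one_smul]
    have hgd : DifferentiableOn ℂ (fun t : ℂ => F (t • ζ)) (ball 0 1) :=
      hF.comp (by fun_prop) hζm
    have hwb : (‖w‖ : ℂ) ∈ ball (0 : ℂ) 1 := by simpa using hw
    obtain ⟨C, hC1, hC⟩ := Complex.affine_of_mapsTo_ball_of_exists_norm_dslope_eq_div'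
      (f := fun t : ℂ => F (t • ζ)) (c := 0) (R₁ := 1) (R₂ := 1) hgd
      (fun t ht => by
        simpa [hF0] using (mem_ball_zero_iff.1 (hFm (hζm ht))).le)
      ⟨‖w‖, hwb, by
        rw [dslope_of_ne _ hwn, slope_def_module]
        simp [hF0, hζw, norm_smul, hnorm w hw, hw0]⟩
    simp only [zero_smul, hF0, sub_zero, zero_add] at hC
    have hdζ : fderiv ℂ F 0 ζ = C := by
      have h1 : HasDerivAt (fun t : ℂ => F (t • ζ)) (fderiv ℂ F 0 ζ) 0 := by
        have h2 : HasFDerivAt F (fderiv ℂ F 0) ((0 : ℂ) • ζ) := by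
          rw [zero_smul]
          exact (hF.differentiableAt (isOpen_ball.mem_nhds h0)).hasFDerivAt
        have h3 := h2.comp_hasDerivAt (0 : ℂ) ((hasDerivAt_id (0 : ℂ)).smul_const ζ)
        rw [one_smul] at h3
        exact h3
      have h3 : HasDerivAt (fun t : ℂ => F (t • ζ)) C 0 := by
        have : HasDerivAt (fun t : ℂ => t • C) ((1 : ℂ) • C) 0 :=
          (hasDerivAt_id (0 : ℂ)).smul_const C
        rw [one_smul] at this
        exact this.congr_of_eventuallyEq
          (hC.eventuallyEq_of_mem (isOpen_ball.mem_nhds (mem_ball_self one_pos)))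
      exact h1.unique h3
    have hFw : F w = fderiv ℂ F 0 w := by
      conv_rhs => rw [← hζw, map_smul, hdζ]
      simpa [hζw] using hC hwb
    exact ⟨by rw [← hFw, hnorm w hw], hFw⟩
  refine ⟨⟨(fderiv ℂ F 0 : E →ₗ[ℂ] E), fun x => ?_⟩, fun z hz => (hhom z hz).2⟩
  have hpos : 0 < 1 + ‖x‖ := by positivity
  have hc : (((1 + ‖x‖ : ℝ) : ℂ))⁻¹ ≠ 0 := inv_ne_zero (Complex.ofReal_ne_zero.2 hpos.ne')
  have hb : (((1 + ‖x‖ : ℝ) : ℂ))⁻¹ • x ∈ ball (0 : E) 1 := by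
    rw [mem_ball_zero_iff, norm_smul, norm_inv, Complex.norm_real, Real.norm_of_nonneg hpos.le,
      inv_mul_lt_iff₀ hpos]
    linarith
  have := (hhom _ hb).1
  rw [map_smul, norm_smul, norm_smul] at this
  exact mul_left_cancel₀ (norm_ne_zero_iff.2 hc) this

end Inverse

/-! ### Involutive automorphisms of the ball -/

section Involution

variable {E : Type*} [NormedAddCommGroup E] [InnerProductSpace ℂ E]

/-- The involutive automorphism of the unit ball which exchanges `a` and `0`. -/
noncomputable def ballInvolution (a z : E) : E :=
  (1 - ⟪a, z⟫_ℂ)⁻¹ • ((1 - (1 + (√(1 - ‖a‖ ^ 2) : ℂ))⁻¹ * ⟪a, z⟫_ℂ) • a -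
    (√(1 - ‖a‖ ^ 2) : ℂ) • z)

lemma one_sub_inner_ne_zero_of_mem {a z : E} (ha : a ∈ ball (0 : E) 1) (hz : z ∈ ball (0 : E) 1) :
    1 - ⟪a, z⟫_ℂ ≠ 0 := by
  rw [mem_ball_zero_iff] at ha hz
  intro h
  have h1 : ‖⟪a, z⟫_ℂ‖ < 1 := by
    refine (norm_inner_le_norm a z).trans_lt ?_
    nlinarith [norm_nonneg a, norm_nonneg z]
  rw [← sub_eq_zero.mp h, norm_one] at h1
  exact lt_irrefl _ h1

variable {a : E}

omit [InnerProductSpace ℂ E] in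
lemma sqrt_one_sub_norm_sq_pos (ha : a ∈ ball (0 : E) 1) : 0 < √(1 - ‖a‖ ^ 2) := by
  rw [mem_ball_zero_iff] at ha
  exact Real.sqrt_pos.2 (by nlinarith [norm_nonneg a])

-- With `s = √(1 - ‖a‖ ^ 2)`, the coefficient `(1 + s)⁻¹` in the involution stands for `(1 - s) /
-- ‖a‖ ^ 2` in the usual formula by projections; the case `a = 0` then needs no separate treatment.
omit [InnerProductSpace ℂ E] in
lemma one_add_sqrt_ne_zero (a : E) : 1 + (√(1 - ‖a‖ ^ 2) : ℂ) ≠ 0 := by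
  have : 0 < 1 + √(1 - ‖a‖ ^ 2) := by positivity
  exact_mod_cast this.ne'

lemma inner_self_eq_one_sub (ha : a ∈ ball (0 : E) 1) :
    ⟪a, a⟫_ℂ = 1 - (√(1 - ‖a‖ ^ 2) : ℂ) ^ 2 := by
  rw [mem_ball_zero_iff] at ha
  have h : √(1 - ‖a‖ ^ 2) ^ 2 = 1 - ‖a‖ ^ 2 := Real.sq_sqrt (by nlinarith [norm_nonneg a])
  rw [inner_self_eq_norm_sq_to_K, ← Complex.ofReal_pow (√(1 - ‖a‖ ^ 2)), h]
  simp

/-- On the diagonal this shows that the ball is preserved; off the diagonal it is the model case of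
the kernel identity. -/
lemma one_sub_inner_ballInvolution (ha : a ∈ ball (0 : E) 1) {z w : E}
    (hz : z ∈ ball (0 : E) 1) (hw : w ∈ ball (0 : E) 1) :
    1 - ⟪ballInvolution a w, ballInvolution a z⟫_ℂ =
      (√(1 - ‖a‖ ^ 2) : ℂ) ^ 2 * (1 - ⟪w, z⟫_ℂ) / ((1 - ⟪a, z⟫_ℂ) * (1 - ⟪w, a⟫_ℂ)) := by
  have h1 := one_sub_inner_ne_zero_of_mem ha hz
  have h2 := one_sub_inner_ne_zero_of_mem hw ha
  have h3 := one_add_sqrt_ne_zero a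
  simp only [ballInvolution, inner_smul_left, inner_smul_right, inner_sub_left, inner_sub_right,
    inner_self_eq_one_sub ha, map_sub, map_mul, map_inv₀, map_one, map_add, Complex.conj_ofReal,
    inner_conj_symm]
  field_simp
  ring

lemma one_sub_inner_right_ballInvolution (ha : a ∈ ball (0 : E) 1) {z : E}
    (hz : z ∈ ball (0 : E) 1) :
    1 - ⟪a, ballInvolution a z⟫_ℂ = (√(1 - ‖a‖ ^ 2) : ℂ) ^ 2 / (1 - ⟪a, z⟫_ℂ) := by
  have h1 := one_sub_inner_ne_zero_of_mem ha hz
  have h3 := one_add_sqrt_ne_zero a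
  simp only [ballInvolution, inner_smul_right, inner_sub_right, inner_self_eq_one_sub ha]
  field_simp
  ring

lemma ballInvolution_mem (ha : a ∈ ball (0 : E) 1) {z : E} (hz : z ∈ ball (0 : E) 1) :
    ballInvolution a z ∈ ball (0 : E) 1 := by
  have h1 := one_sub_inner_ne_zero_of_mem ha hz
  have h := one_sub_inner_ballInvolution ha hz hz
  rw [← inner_conj_symm z a, inner_self_eq_norm_sq_to_K, inner_self_eq_norm_sq_to_K,
    ← map_one (starRingEnd ℂ), ← map_sub, map_one, Complex.mul_conj, Complex.normSq_eq_norm_sq,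
    Complex.ofReal_pow] at h
  have h' : 1 - ‖ballInvolution a z‖ ^ 2 =
      √(1 - ‖a‖ ^ 2) ^ 2 * (1 - ‖z‖ ^ 2) / ‖1 - ⟪a, z⟫_ℂ‖ ^ 2 := by
    apply Complex.ofReal_injective
    push_cast
    exact h
  have hz' : 0 < 1 - ‖z‖ ^ 2 := by
    rw [mem_ball_zero_iff] at hz
    nlinarith [norm_nonneg z]
  have hpos : 0 < 1 - ‖ballInvolution a z‖ ^ 2 := by
    rw [h']
    have := sqrt_one_sub_norm_sq_pos ha
    have := norm_pos_iff.2 h1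
    positivity
  rw [mem_ball_zero_iff]
  nlinarith [norm_nonneg (ballInvolution a z)]

lemma ballInvolution_ballInvolution (ha : a ∈ ball (0 : E) 1) {z : E} (hz : z ∈ ball (0 : E) 1) :
    ballInvolution a (ballInvolution a z) = z := by
  have h1 := one_sub_inner_ne_zero_of_mem ha hz
  have h2 := one_sub_inner_right_ballInvolution ha hz
  have h3 := one_add_sqrt_ne_zero a
  have h4 : (√(1 - ‖a‖ ^ 2) : ℂ) ≠ 0 := by exact_mod_cast (sqrt_one_sub_norm_sq_pos ha).ne'
  have h5 : ⟪a, ballInvolution a z⟫_ℂ = 1 - (√(1 - ‖a‖ ^ 2) : ℂ) ^ 2 / (1 - ⟪a, z⟫_ℂ) := by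
    rw [← h2]
    ring
  rw [ballInvolution, h2, h5, ballInvolution]
  simp only [smul_sub, smul_smul]
  match_scalars
  · field_simp
    ring
  · field_simp

lemma ballInvolution_self (ha : a ∈ ball (0 : E) 1) : ballInvolution a a = 0 := by
  have h3 := one_add_sqrt_ne_zero a
  have h : (1 - (1 + (√(1 - ‖a‖ ^ 2) : ℂ))⁻¹ * ⟪a, a⟫_ℂ) = (√(1 - ‖a‖ ^ 2) : ℂ) := by
    rw [inner_self_eq_one_sub ha]
    field_simp
    ring
  rw [ballInvolution, h, sub_self, smul_zero]

lemma ballInvolution_zero (a : E) : ballInvolution a 0 = a := by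
  simp [ballInvolution]

lemma differentiableOn_ballInvolution (ha : a ∈ ball (0 : E) 1) :
    DifferentiableOn ℂ (ballInvolution a) (ball 0 1) := by
  have h1 : Differentiable ℂ fun z : E => ⟪a, z⟫_ℂ := (innerSL ℂ a).differentiable
  unfold ballInvolution
  refine DifferentiableOn.smul ?_ ?_
  · exact ((differentiable_const _).sub h1).differentiableOn.inv
      fun z hz => one_sub_inner_ne_zero_of_mem ha hz
  · refine Differentiable.differentiableOn ?_
    exact (((differentiable_const _).sub (h1.const_mul _)).smul_const a).sub
      (differentiable_id.const_smul _)

end Involution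

/-- A holomorphic bijection of the ball with continuous inverse transforms `1 - ⟨z, w⟩` by a
Hermitian factor of rank one. -/
theorem exists_one_sub_inner_eq {E : Type*} [NormedAddCommGroup E] [InnerProductSpace ℂ E]
    [FiniteDimensional ℂ E] {φ ψ : E → E} (hφ : DifferentiableOn ℂ φ (ball 0 1))
    (hφm : MapsTo φ (ball 0 1) (ball 0 1))
    (hψ : ContinuousOn ψ (ball 0 1)) (hψm : MapsTo ψ (ball 0 1) (ball 0 1))
    (hleft : ∀ z ∈ ball 0 1, ψ (φ z) = z) (hright : ∀ w ∈ ball 0 1, φ (ψ w) = w) :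
    ∃ q : E → ℂ, ∀ z ∈ ball (0 : E) 1, ∀ w ∈ ball (0 : E) 1,
      1 - ⟪φ w, φ z⟫_ℂ = q z * conj (q w) * (1 - ⟪w, z⟫_ℂ) := by
  have h0 : (0 : E) ∈ ball (0 : E) 1 := mem_ball_self one_pos
  -- The base point is not `0` but some `b` where the inverse is known to be differentiable. Moving
  -- `b` and `ψ b` to the origin meets the hypotheses of Cartan's theorem.
  obtain ⟨b, hb, hdet⟩ := closure_nonempty_iff.1 ⟨0, dense_det_ne_zero hφ hψm hright h0⟩
  have hψd := differentiableAt_inverse hφ hψ hψm hright hb hdet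
  have ha := hψm hb
  set a := ψ b with hab
  have hma : MapsTo (ballInvolution a) (ball 0 1) (ball 0 1) := fun z hz => ballInvolution_mem ha hz
  have hmb : MapsTo (ballInvolution b) (ball 0 1) (ball 0 1) := fun z hz => ballInvolution_mem hb hz
  obtain ⟨A, hA⟩ := exists_linearIsometry_eqOn (F := ballInvolution b ∘ φ ∘ ballInvolution a)
    (ψ := ballInvolution a ∘ ψ ∘ ballInvolution b)
    ((differentiableOn_ballInvolution hb).comp
      (hφ.comp (differentiableOn_ballInvolution ha) hma) (hφm.comp hma))
    (hmb.comp (hφm.comp hma))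
    ((differentiableOn_ballInvolution ha).continuousOn.comp
      (hψ.comp (differentiableOn_ballInvolution hb).continuousOn hmb) (hψm.comp hmb))
    (hma.comp (hψm.comp hmb))
    (fun z hz => by
      simp [ballInvolution_ballInvolution hb (hφm (hma hz)), hleft _ (hma hz),
        ballInvolution_ballInvolution ha hz])
    (fun z hz => by
      simp [ballInvolution_ballInvolution ha (hψm (hmb hz)), hright _ (hmb hz),
        ballInvolution_ballInvolution hb hz])
    (by simp [ballInvolution_zero, hab, hright b hb, ballInvolution_self hb])
    (by
      refine DifferentiableAt.comp 0 ?_ (DifferentiableAt.comp 0 ?_ ?_)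
      · refine (differentiableOn_ballInvolution ha).differentiableAt (isOpen_ball.mem_nhds ?_)
        exact hψm (hmb h0)
      · rwa [ballInvolution_zero]
      · exact (differentiableOn_ballInvolution hb).differentiableAt (isOpen_ball.mem_nhds h0))
  have hAz : ∀ z ∈ ball (0 : E) 1, ballInvolution b (φ z) = A (ballInvolution a z) := by
    intro z hz
    simpa [ballInvolution_ballInvolution ha hz] using hA (hma hz)
  -- The isometry `A` preserves inner products, so the laws for the two involutions can be equated;
  -- `q` is the quotient of their factors.
  refine ⟨fun z => (√(1 - ‖a‖ ^ 2) : ℂ) / (√(1 - ‖b‖ ^ 2) : ℂ) *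
    ((1 - ⟪b, φ z⟫_ℂ) / (1 - ⟪a, z⟫_ℂ)), fun z hz w hw => ?_⟩
  have h1 : 1 - ⟪ballInvolution b (φ w), ballInvolution b (φ z)⟫_ℂ
      = 1 - ⟪ballInvolution a w, ballInvolution a z⟫_ℂ := by
    rw [hAz z hz, hAz w hw, A.inner_map_map]
  rw [one_sub_inner_ballInvolution hb (hφm hz) (hφm hw),
    one_sub_inner_ballInvolution ha hz hw] at h1
  have e1 := one_sub_inner_ne_zero_of_mem hb (hφm hz)
  have e2 := one_sub_inner_ne_zero_of_mem (hφm hw) hb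
  have e3 := one_sub_inner_ne_zero_of_mem ha hz
  have e4 := one_sub_inner_ne_zero_of_mem hw ha
  have e5 : (√(1 - ‖b‖ ^ 2) : ℂ) ≠ 0 := by exact_mod_cast (sqrt_one_sub_norm_sq_pos hb).ne'
  simp only [map_mul, map_div₀, Complex.conj_ofReal, map_sub, map_one, inner_conj_symm]
  field_simp at h1 ⊢
  linear_combination h1

/-! ## Multiplication and weighted composition operators on `H_d^2` -/

lemma ker_self_ne_zero {d : ℕ} (z : Ball d) : ker z z ≠ 0 :=
  one_div_ne_zero (one_sub_inner_ne_zero z z)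

lemma norm_kfun_sq {d : ℕ} (w : Ball d) : ((‖(kfun w : H2 d)‖ : ℝ) : ℂ) ^ 2 = ker w w := by
  rw [← kfun_apply, ← inner_kfun, inner_self_eq_norm_sq_to_K]
  rfl

lemma norm_linearCombination_eq {ι H : Type*} [NormedAddCommGroup H] [InnerProductSpace ℂ H]
    {u v : ι → H} (h : ∀ i j, ⟪u i, u j⟫_ℂ = ⟪v i, v j⟫_ℂ) (c : ι →₀ ℂ) :
    ‖Finsupp.linearCombination ℂ u c‖ = ‖Finsupp.linearCombination ℂ v c‖ := by
  have : ⟪Finsupp.linearCombination ℂ u c, Finsupp.linearCombination ℂ u c⟫_ℂ =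
      ⟪Finsupp.linearCombination ℂ v c, Finsupp.linearCombination ℂ v c⟫_ℂ := by
    simp only [Finsupp.linearCombination_apply, Finsupp.sum, sum_inner, inner_sum,
      inner_smul_left, inner_smul_right, h]
  rw [@norm_eq_sqrt_re_inner ℂ, @norm_eq_sqrt_re_inner ℂ, this]

lemma denseRange_linearCombination {ι H : Type*} [NormedAddCommGroup H] [InnerProductSpace ℂ H]
    [CompleteSpace H] {u : ι → H} (h : ∀ f, (∀ i, ⟪u i, f⟫_ℂ = 0) → f = 0) :
    DenseRange (Finsupp.linearCombination ℂ u) := by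
  have h1 : (LinearMap.range (Finsupp.linearCombination ℂ u)).topologicalClosure = ⊤ := by
    rw [Submodule.topologicalClosure_eq_top_iff, Submodule.eq_bot_iff]
    intro f hf
    exact h f fun i => (Submodule.mem_orthogonal _ f).mp hf (u i) ⟨Finsupp.single i 1, by simp⟩
  rw [DenseRange, ← LinearMap.coe_range, dense_iff_closure_eq,
    ← Submodule.topologicalClosure_coe, h1, Submodule.top_coe]

/-- Two continuous linear maps which agree on the kernel functions are equal. -/
lemma ext_kfun {d : ℕ} {K : Type*} [NormedAddCommGroup K] [NormedSpace ℂ K] {S T : H2 d →L[ℂ] K}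
    (h : ∀ w, S (kfun w) = T (kfun w)) : S = T := by
  refine ContinuousLinearMap.ext fun x => ?_
  refine (denseRange_kfun d).induction_on (p := fun x => S x = T x) x
    (isClosed_eq S.continuous T.continuous) fun c => ?_
  simp only [Finsupp.linearCombination_apply, Finsupp.sum, map_sum, map_smul, h]

lemma adjoint_kfun {d : ℕ} {T : H2 d →L[ℂ] H2 d} {g : Ball d → ℂ}
    (h : ∀ (ξ : H2 d) (z : Ball d), T ξ z = g z * ξ z) (w : Ball d) :
    T.adjoint (kfun w) = conj (g w) • kfun w := by
  refine ext_inner_right ℂ fun ξ => ?_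
  rw [ContinuousLinearMap.adjoint_inner_left, inner_kfun, h, inner_smul_left, inner_kfun,
    Complex.conj_conj]

/-- A weighted composition operator which is compatible with the kernel is unitary. -/
theorem exists_weightedComposition {d : ℕ} {σ : Ball d → Ball d} (hσ : Function.Surjective σ)
    {m : Ball d → ℂ} (h : ∀ z w, m z * conj (m w) * ker (σ z) (σ w) = ker z w) :
    ∃ U : H2 d ≃ₗᵢ[ℂ] H2 d, ∀ (ξ : H2 d) (z : Ball d), U ξ z = m z * ξ (σ z) := by
  have hm : ∀ z, m z ≠ 0 := fun z hz => ker_self_ne_zero z (by rw [← h, hz]; simp)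
  -- These are the images that the adjoint of the desired operator must assign to the kernel
  -- functions. Surjectivity of `σ` makes them total, and the kernel law gives them the right Gram
  -- matrix.
  set u : Ball d → H2 d := fun w => conj (m w) • kfun (σ w)
  have hu : ∀ w (f : H2 d), ⟪u w, f⟫_ℂ = m w * f (σ w) := fun w f => by
    rw [inner_smul_left, inner_kfun, Complex.conj_conj]
  have hdense : DenseRange (Finsupp.linearCombination ℂ u) := by
    refine denseRange_linearCombination fun f hf => RKHS.ext fun z => ?_
    obtain ⟨w, rfl⟩ := hσ z
    simpa [hu, hm] using hf w
  have hgram : ∀ w z, ⟪u w, u z⟫_ℂ = ⟪(kfun w : H2 d), kfun z⟫_ℂ := fun w z => by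
    rw [hu, inner_kfun, kfun_apply, ← h]
    simp [u, kfun_apply]
    ring
  set V := (LinearEquiv.refl ℂ (Ball d →₀ ℂ)).extendOfIsometry
    (Finsupp.linearCombination ℂ (kfun : Ball d → H2 d)) (Finsupp.linearCombination ℂ u)
    (denseRange_kfun d) hdense (fun c => norm_linearCombination_eq hgram c)
  have hV : ∀ w, V (kfun w) = u w := fun w => by
    have := LinearEquiv.extendOfIsometry_eq (LinearEquiv.refl ℂ (Ball d →₀ ℂ))
      (Finsupp.linearCombination ℂ (kfun : Ball d → H2 d)) (Finsupp.linearCombination ℂ u)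
      (denseRange_kfun d) hdense (fun c => norm_linearCombination_eq hgram c)
      (Finsupp.single w 1)
    simpa using this
  refine ⟨V.symm, fun ξ z => ?_⟩
  rw [← hu, ← hV, ← inner_kfun, ← V.inner_map_map (kfun z), V.apply_symm_apply]

/-! ## Contractivity and purity -/

/-- For a finite combination of kernel functions the defect is exactly `‖∑ c w‖ ^ 2`, the squared
modulus of its value at the origin; density does the rest. -/
lemma sum_norm_sq_adjoint_le {d : ℕ} (x : H2 d) :
    ∑ k, ‖(H2Module d (MvPolynomial.X k)).adjoint x‖ ^ 2 ≤ ‖x‖ ^ 2 := by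
  refine (denseRange_kfun d).induction_on
    (p := fun x => ∑ k, ‖(H2Module d (MvPolynomial.X k)).adjoint x‖ ^ 2 ≤ ‖x‖ ^ 2) x
    (isClosed_le (by fun_prop) (by fun_prop)) fun c => ?_
  have h : ∀ k, (H2Module d (MvPolynomial.X k)).adjoint
      (Finsupp.linearCombination ℂ (kfun : Ball d → H2 d) c) =
      Finsupp.linearCombination ℂ (fun w => conj (w.1 k) • (kfun w : H2 d)) c := fun k => by
    have := adjoint_kfun (T := H2Module d (MvPolynomial.X k)) (g := fun z => z.1 k)
      fun ξ z => by simp [H2Module_apply]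
    simp only [Finsupp.linearCombination_apply, Finsupp.sum, map_sum, map_smul, this]
  simp only [h]
  rw [← sum_norm_sq_linearCombination c]
  exact le_add_of_nonneg_right (sq_nonneg _)

/-- A row of operators is contractive as soon as its adjoint column is: pair the row sum `y` with
itself and use Cauchy–Schwarz to bound `‖y‖ ^ 4` by `(∑ ‖ξ k‖ ^ 2) * ‖y‖ ^ 2`. -/
lemma isContractive_of_sum_norm_sq_adjoint_le {d : ℕ} {H : Type*} [NormedAddCommGroup H]
    [InnerProductSpace ℂ H] [CompleteSpace H] {ρ : HilbertModule d H}
    (h : ∀ x, ∑ k, ‖(ρ (MvPolynomial.X k)).adjoint x‖ ^ 2 ≤ ‖x‖ ^ 2) : IsContractive ρ := by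
  intro ξ
  set y := ∑ k, ρ (MvPolynomial.X k) (ξ k) with hy
  have h1 : ‖y‖ ^ 2 ≤ ∑ k, ‖ξ k‖ * ‖(ρ (MvPolynomial.X k)).adjoint y‖ := by
    have h2 : (‖y‖ : ℂ) ^ 2 = ∑ k, ⟪ξ k, (ρ (MvPolynomial.X k)).adjoint y⟫_ℂ := by
      simp only [ContinuousLinearMap.adjoint_inner_right, ← sum_inner, ← hy]
      exact (inner_self_eq_norm_sq_to_K y).symm
    have h3 := congrArg norm h2
    rw [norm_pow, Complex.norm_real, norm_norm] at h3
    rw [h3]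
    exact (norm_sum_le _ _).trans (Finset.sum_le_sum fun k _ => norm_inner_le_norm _ _)
  have h4 := Finset.sum_mul_sq_le_sq_mul_sq Finset.univ (fun k => ‖ξ k‖)
    (fun k => ‖(ρ (MvPolynomial.X k)).adjoint y‖)
  have h5 : (‖y‖ ^ 2) ^ 2 ≤ (∑ k, ‖ξ k‖ ^ 2) * ‖y‖ ^ 2 :=
    (pow_le_pow_left₀ (sq_nonneg _) h1 2).trans (h4.trans
      (mul_le_mul_of_nonneg_left (h y) (Finset.sum_nonneg fun k _ => sq_nonneg _)))
  rcases (sq_nonneg ‖y‖).eq_or_lt with h0 | h0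
  · rw [← h0]
    exact Finset.sum_nonneg fun k _ => sq_nonneg _
  · rw [sq (‖y‖ ^ 2)] at h5
    exact le_of_mul_le_mul_right h5 h0

/-- The `*`-representation carries `∑ z_i * conj z_i = 1` on the sphere to `∑ S_i S_i* = 1`. -/
lemma sum_norm_sq_adjoint_sphericalModule {d : ℕ} {K : Type*} [NormedAddCommGroup K]
    [InnerProductSpace ℂ K] [CompleteSpace K] (π : C(Sphere d, ℂ) →⋆ₐ[ℂ] (K →L[ℂ] K)) (y : K) :
    ∑ i, ‖(sphericalModule π (MvPolynomial.X i)).adjoint y‖ ^ 2 = ‖y‖ ^ 2 := by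
  have hX : ∀ i, sphericalModule π (MvPolynomial.X i) =
      π (⟨fun z => z.1 i, by fun_prop⟩ : C(Sphere d, ℂ)) := fun i => by
    simp [sphericalModule]
  have hsum : ∑ i, sphericalModule π (MvPolynomial.X i) ∘L
      (sphericalModule π (MvPolynomial.X i)).adjoint = ContinuousLinearMap.id ℂ K := by
    have h1 : ∑ i, (⟨fun z => z.1 i, by fun_prop⟩ : C(Sphere d, ℂ)) *
        star (⟨fun z => z.1 i, by fun_prop⟩ : C(Sphere d, ℂ)) = 1 := by
      ext z
      have hz : ‖(z : EuclideanSpace ℂ (Fin d))‖ = 1 := mem_sphere_zero_iff_norm.1 z.2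
      have h2 := EuclideanSpace.norm_sq_eq z.1
      rw [hz] at h2
      simp only [ContinuousMap.coe_sum, Finset.sum_apply, ContinuousMap.mul_apply,
        ContinuousMap.star_apply, ContinuousMap.coe_mk, ContinuousMap.one_apply]
      simp only [RCLike.star_def, Complex.mul_conj, Complex.normSq_eq_norm_sq]
      rw [one_pow] at h2
      exact_mod_cast h2.symm
    have h3 := congrArg π h1
    simp only [map_sum, map_mul, map_star, map_one, ← hX] at h3
    exact h3
  have h4 := congrArg (fun T : K →L[ℂ] K => ⟪y, T y⟫_ℂ) hsum
  simp only [_root_.sum_apply, ContinuousLinearMap.comp_apply, inner_sum,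
    ← ContinuousLinearMap.adjoint_inner_left, ContinuousLinearMap.id_apply,
    inner_self_eq_norm_sq_to_K] at h4
  exact_mod_cast h4

/-- If the coordinates act on `H_d^2` as multiplication by the components of a map into the open
ball, then the spherical part of any minimal dilation is trivial. -/
theorem subsingleton_of_isMinimalDilation {d : ℕ} {ρ : HilbertModule d (H2 d)}
    {σ : Ball d → Ball d}
    (hρ : ∀ (i : Fin d) (ξ : H2 d) (z : Ball d), ρ (MvPolynomial.X i) ξ z = (σ z).1 i * ξ z)
    {ι K : Type*} [NormedAddCommGroup K] [InnerProductSpace ℂ K] [CompleteSpace K]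
    {π : C(Sphere d, ℂ) →⋆ₐ[ℂ] (K →L[ℂ] K)} {U : WithLp 2 (Free d ι × K) →L[ℂ] H2 d}
    (hU : IsMinimalDilation ρ ι π U) : Subsingleton K := by
  -- The spherical component of `U*`; it intertwines the adjoint actions.
  set B : H2 d →L[ℂ] K := WithLp.sndL 2 ℂ (Free d ι) K ∘L U.adjoint with hB
  have hBk : ∀ x k, ⟪B x, k⟫_ℂ = ⟪x, U (WithLp.toLp 2 (0, k))⟫_ℂ := fun x k => by
    rw [← ContinuousLinearMap.adjoint_inner_left]
    simp [hB, WithLp.prod_inner_apply]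
  have hint : ∀ i x, B ((ρ (MvPolynomial.X i)).adjoint x) =
      (sphericalModule π (MvPolynomial.X i)).adjoint (B x) := fun i x => by
    refine ext_inner_right ℂ fun k => ?_
    rw [hBk, ContinuousLinearMap.adjoint_inner_left, ContinuousLinearMap.adjoint_inner_left, hBk,
      ← hU.isModuleHom]
    congr 2
    simp [directSum]
  -- On `k_w` the eigenvalue relation gives `‖σ w‖ ^ 2 * ‖B k_w‖ ^ 2 = ‖B k_w‖ ^ 2` with `‖σ w‖ <
  -- 1`.
  have hB0 : B = 0 := by
    refine ext_kfun fun w => ?_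
    have h1 := sum_norm_sq_adjoint_sphericalModule π (B (kfun w))
    simp only [← hint, adjoint_kfun (hρ _), map_smul, norm_smul, mul_pow, RCLike.norm_conj] at h1
    rw [← Finset.sum_mul, ← EuclideanSpace.norm_sq_eq] at h1
    have h2 : ‖(σ w).1‖ < 1 := mem_ball_zero_iff.1 (σ w).2
    have h3 : ‖(σ w).1‖ ^ 2 < 1 := by nlinarith [norm_nonneg (σ w).1]
    have h4 : ‖B (kfun w)‖ ^ 2 = 0 := by nlinarith [sq_nonneg ‖B (kfun w)‖]
    simpa using h4
  -- Now `U*` takes values in the closed submodule `F ⊕ 0`, which by minimality is everything.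
  have hN := hU.minimal (LinearMap.ker (WithLp.sndL 2 ℂ (Free d ι) K).toLinearMap)
    (ContinuousLinearMap.isClosed_ker _) (fun p x hx => by
      have hx' : x.snd = 0 := hx
      simp [directSum, hx'])
    (fun x => DFunLike.congr_fun hB0 x)
  refine subsingleton_of_forall_eq 0 fun k => ?_
  have hk : (WithLp.toLp 2 (0, k) : WithLp 2 (Free d ι × K)) ∈
      LinearMap.ker (WithLp.sndL 2 ℂ (Free d ι) K).toLinearMap := hN ▸ Submodule.mem_top
  simpa using hk

/-- The free module of rank one is `H_d^2`. -/
noncomputable def freeUniqueEquiv (d : ℕ) (ι : Type*) [Unique ι] : Free d ι ≃ₗᵢ[ℂ] H2 d where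
  toFun f := f default
  map_add' _ _ := rfl
  map_smul' _ _ := rfl
  invFun x := lp.single (E := fun _ : ι => H2 d) 2 default x
  left_inv f := by
    ext i : 2
    rw [Unique.eq_default i]
    exact lp.single_apply_self (E := fun _ : ι => H2 d) 2 default _
  right_inv x := lp.single_apply_self (E := fun _ : ι => H2 d) 2 default x
  norm_map' f := by
    have h : lp.single (E := fun _ : ι => H2 d) 2 default (f default) = f := by
      ext i : 2
      rw [Unique.eq_default i]
      exact lp.single_apply_self (E := fun _ : ι => H2 d) 2 default _
    conv_rhs => rw [← h]
    exact (lp.norm_single (E := fun _ : ι => H2 d) (p := 2) two_pos default (f default)).symm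

lemma isQuotientOfFree_of_isModuleHom {d : ℕ} {H : Type u} [NormedAddCommGroup H]
    [InnerProductSpace ℂ H] {ρ : HilbertModule d H} (U : H2 d ≃ₗᵢ[ℂ] H)
    (hU : IsModuleHom (H2Module d) ρ U) : IsQuotientOfFree ρ := by
  have hcl : IsClosed ((⊥ : Submodule ℂ (Free d PUnit.{u + 1})) : Set (Free d PUnit.{u + 1})) := by
    rw [Submodule.bot_coe]
    exact isClosed_singleton
  refine ⟨PUnit, ⊥, hcl, fun p x hx => ?_, ?_⟩
  · rw [Submodule.mem_bot] at hx ⊢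
    rw [hx, map_zero]
  · let Q : (Free d PUnit.{u + 1} ⧸ (⊥ : Submodule ℂ (Free d PUnit.{u + 1}))) ≃ₗᵢ[ℂ]
        Free d PUnit.{u + 1} :=
      { Submodule.quotEquivOfEqBot ⊥ rfl with
        norm_map' := fun x => by
          obtain ⟨x, rfl⟩ := Submodule.Quotient.mk_surjective _ x
          have : ‖(Submodule.Quotient.mk x :
              Free d PUnit.{u + 1} ⧸ (⊥ : Submodule ℂ (Free d PUnit.{u + 1})))‖ = ‖x‖ := by
            refine (QuotientAddGroup.norm_mk
              (S := (⊥ : Submodule ℂ (Free d PUnit.{u + 1})).toAddSubgroup) x).trans ?_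
            simp
          rw [this]
          rfl }
    refine ⟨(Q.trans (freeUniqueEquiv d _)).trans U, fun p x => ?_⟩
    exact hU p (x default)

/-! ### The kernel under a Möbius transform -/

/-- A continuous map from a compact set to a Hausdorff space is closed. Continuity of a Möbius
transform up to the boundary is used only here, to make its inverse continuous. -/
lemma continuousOn_of_leftInvOn {X Y : Type*} [TopologicalSpace X] [TopologicalSpace Y] [T2Space Y]
    {f : X → Y} {g : Y → X} {s : Set X} {t : Set Y} (hs : IsCompact s) (hf : ContinuousOn f s)
    (hst : BijOn f s t) (hg : LeftInvOn g f s) : ContinuousOn g t := by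
  refine continuousOn_iff_isClosed.2 fun u hu => ⟨f '' (s ∩ u),
    ((hs.inter_right hu).image_of_continuousOn (hf.mono inter_subset_left)).isClosed, ?_⟩
  ext y
  constructor
  · rintro ⟨hyu, hyt⟩
    obtain ⟨x, hx, rfl⟩ := hst.surjOn hyt
    exact ⟨⟨x, ⟨hx, by rwa [mem_preimage, hg hx] at hyu⟩, rfl⟩, hyt⟩
  · rintro ⟨⟨x, ⟨hx, hxu⟩, rfl⟩, hyt⟩
    exact ⟨by rwa [mem_preimage, hg hx], hyt⟩

lemma IsMobius.surjective_onBall {d : ℕ}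
    {φ : EuclideanSpace ℂ (Fin d) → EuclideanSpace ℂ (Fin d)} (hφ : IsMobius φ) :
    Function.Surjective hφ.onBall := fun w => by
  obtain ⟨z, hz, hzw⟩ := hφ.image_ball.superset w.2
  exact ⟨⟨z, hz⟩, Subtype.ext hzw⟩

lemma IsMobius.exists_one_sub_inner_eq {d : ℕ}
    {φ : EuclideanSpace ℂ (Fin d) → EuclideanSpace ℂ (Fin d)} (hφ : IsMobius φ) :
    ∃ q : Ball d → ℂ, ∀ z w : Ball d,
      1 - ⟪(hφ.onBall w).1, (hφ.onBall z).1⟫_ℂ = q z * conj (q w) * (1 - ⟪w.1, z.1⟫_ℂ) := by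
  have hinv := hφ.bijOn.invOn_invFunOn
  have hsub : ball (0 : EuclideanSpace ℂ (Fin d)) 1 ⊆ closedBall 0 1 := ball_subset_closedBall
  have hψ := continuousOn_of_leftInvOn (isCompact_closedBall 0 1) hφ.continuousOn hφ.bijOn hinv.1
  obtain ⟨q, hq⟩ := HilbertModules.exists_one_sub_inner_eq hφ.holomorphic
    (mapsTo_iff_image_subset.2 hφ.image_ball.subset) (hψ.mono hsub)
    (fun w hw => by
      obtain ⟨z, hz, rfl⟩ := hφ.image_ball.superset hw
      rwa [hinv.1 (hsub hz)])
    (fun z hz => hinv.1 (hsub hz)) (fun w hw => hinv.2 (hsub hw))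
  exact ⟨fun z => q z, fun z w => hq z z.2 w w.2⟩

/-- The transformation law of the kernel under a Möbius transform. -/
lemma IsMobius.ker_onBall {d : ℕ}
    {φ : EuclideanSpace ℂ (Fin d) → EuclideanSpace ℂ (Fin d)} (hφ : IsMobius φ) {lam : Ball d}
    (hlam : φ lam = 0) (z w : Ball d) :
    kfun lam z / ((‖(kfun lam : H2 d)‖ : ℝ) : ℂ) *
      conj (kfun lam w / ((‖(kfun lam : H2 d)‖ : ℝ) : ℂ)) * ker (hφ.onBall z) (hφ.onBall w)
      = ker z w := by
  obtain ⟨q, hq⟩ := hφ.exists_one_sub_inner_eq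
  have hlam' : (hφ.onBall lam).1 = 0 := hlam
  -- At `w = lam` the left side of the identity is `1`, which determines `q` up to a constant; at `z
  -- = lam` as well it gives `‖k_λ‖ ^ 2 = q lam * conj (q lam)`.
  have h1 : ∀ z, ker z lam = q z * conj (q lam) := fun z => by
    have := hq z lam
    rw [hlam', inner_zero_left, sub_zero] at this
    exact (eq_div_of_mul_eq (one_sub_inner_ne_zero z lam) this.symm).symm
  have hq0 : ∀ z, q z ≠ 0 := fun z h => by
    have := one_sub_inner_ne_zero (hφ.onBall z) (hφ.onBall z)
    rw [hq, h] at this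
    simp at this
  have hc0 : ∀ z, conj (q z) ≠ 0 := fun z => (map_ne_zero _).2 (hq0 z)
  have h2 : ker (hφ.onBall z) (hφ.onBall w) = ker z w / (q z * conj (q w)) := by
    rw [ker, ker, hq]
    field_simp [one_sub_inner_ne_zero z w, hq0 z, hc0 w]
  have h3 := norm_kfun_sq lam
  rw [h1] at h3
  have h4 : ((‖(kfun lam : H2 d)‖ : ℝ) : ℂ) ≠ 0 := fun h => by
    rw [h] at h3
    simp [hq0] at h3
  have := hq0 z
  have := hq0 lam
  have := hc0 w
  have := hc0 lam
  simp only [kfun_apply, h1, h2, map_div₀, map_mul, Complex.conj_ofReal, Complex.conj_conj]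
  field_simp
  rw [h3]
  ring

end HilbertModules

/-! ### Transport of the module structure along `U_φ` -/

open HilbertModules
theorem mainTheorem4 (d : ℕ) (φ : EuclideanSpace ℂ (Fin d) → EuclideanSpace ℂ (Fin d))
    (hφ : IsMobius φ) :
    -- the module `(H_d^2)_φ` exists (it is unique by `IsMobiusModule.unique`), and it is
    -- contractive and pure
    ∃ ρ : HilbertModule d (H2 d), IsMobiusModule φ ρ ∧ IsContractive ρ ∧ IsPure ρ ∧
      -- the point `lam = φ⁻¹(0)`
      ∃ lam : Ball d, (∀ z ∈ Metric.closedBall (0 : EuclideanSpace ℂ (Fin d)) 1,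
          φ z = 0 ↔ z = (lam : EuclideanSpace ℂ (Fin d))) ∧
        -- `U_φ` is a well-defined unitary module isomorphism from `H_d^2` onto `(H_d^2)_φ`
        ∃ U : H2 d ≃ₗᵢ[ℂ] H2 d,
          (∀ (ξ : H2 d) (z : Ball d),
            U ξ z = ξ (hφ.onBall z) * (kfun lam z / ((‖kfun lam‖ : ℝ) : ℂ))) ∧
          IsModuleHom (H2Module d) ρ U := by
  obtain ⟨lam, hlam, hlam0⟩ := hφ.image_ball.superset (Metric.mem_ball_self one_pos)
  lift lam to Ball d using hlam
  obtain ⟨U, hU⟩ := exists_weightedComposition hφ.surjective_onBall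
    (m := fun z => kfun lam z / ((‖(kfun lam : H2 d)‖ : ℝ) : ℂ)) (hφ.ker_onBall hlam0)
  -- Defining the action by conjugation with `U` gives all polynomials, and the homomorphism
  -- property, at once; only the coordinates remain to be identified with multiplication by the
  -- components of `φ`.
  let ρ : HilbertModule d (H2 d) :=
    (U.toContinuousLinearEquiv.conjContinuousAlgEquiv : (H2 d →L[ℂ] H2 d) →ₐ[ℂ] _).comp
      (H2Module d)
  have hρ : ∀ p x, ρ p x = U (H2Module d p (U.symm x)) := fun p x => rfl
  have hhom : IsModuleHom (H2Module d) ρ U := fun p x => by rw [hρ, U.symm_apply_apply]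
  have hmob : IsMobiusModule φ ρ := fun i ξ z => by
    obtain ⟨ξ, rfl⟩ := U.surjective ξ
    rw [← hhom, hU, hU, H2Module_apply, MvPolynomial.eval_X]
    simp only [IsMobius.onBall]
    ring
  refine ⟨ρ, hmob, fun ξ => ?_, ⟨fun ι K _ _ _ π V hV => ?_, ?_⟩, lam, fun z hz => ?_, U,
    fun ξ z => ?_, hhom⟩
  · have := isContractive_of_sum_norm_sq_adjoint_le sum_norm_sq_adjoint_le fun k => U.symm (ξ k)
    simpa only [hρ, ← map_sum, U.norm_map, U.symm.norm_map] using this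
  · exact subsingleton_of_isMinimalDilation (σ := hφ.onBall) hmob hV
  · exact isQuotientOfFree_of_isModuleHom U hhom
  · constructor
    · exact fun h => hφ.bijOn.injOn hz (Metric.ball_subset_closedBall lam.2) (h.trans hlam0.symm)
    · rintro rfl
      exact hlam0
  · rw [hU, mul_comm]
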